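/- Let $f^{[a]},f^{[b]}:\mathbb{R}^D\to\mathbb{R}^D$ be $C^\infty$ vector fields with (local) flows $\varphi^{a}_t$ of $x'=f^{[a]}(x)$ and $\varphi^{b}_t$ of $x'=f^{[b]}(x)$, and let $\varphi_\tau$ be the exact flow of $x'=f^{[a]}(x)+\varepsilon f^{[b]}(x)$. (The flow of $x'=\varepsilon f^{[b]}(x)$ is then $\varphi^{[b]}_\tau=\varphi^{b}_{\varepsilon\tau}$.) For $s\ge 0$ and real coefficients $a_1,\dots,a_{s+1}$, $b_1,\dots,b_s$ consider the splitting method $$\psi_\tau=\varphi^{a}_{a_{s+1}\tau}\circ\varphi^{b}_{b_s\varepsilon\tau}\circ\varphi^{a}_{a_s\tau}\circ\cdots\circ\varphi^{b}_{b_1\varepsilon\tau}\circ\varphi^{a}_{a_1\tau},$$ which is called symmetric if $a_{s+2-i}=a_i$ and $b_{s+1-i}=b_i$ for all $i$. A method $\psi_\tau$ for this system has generalized order $(r_1,\dots,r_m)$, where $r_1\ge\cdots\ge r_m$, if for every $x$ $$\psi_\tau(x)-\varphi_\tau(x)=\mathcal{O}\bigl(|\varepsilon|\,|\tau|^{r_1+1}+|\varepsilon|^2|\tau|^{r_2+1}+\cdots+|\varepsilon|^m|\tau|^{r_m+1}\bigr)\quad\text{as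 }(\tau,\varepsilon)\to(0,0).$$ Let $\chi_h$ be one step of size $h$ of an arbitrary smooth symmetric integrator of order two for $x'=f^{[b]}(x)$: near every point and for small $h$, $\chi_h(x)$ is $C^\infty$ in $(h,x)$, $\chi_{-h}=\chi_h^{-1}$, and $\chi_h(x)=\varphi^{b}_h(x)+\mathcal{O}(h^3)$. One step of size $t$ for $x'=\varepsilon f^{[b]}(x)$ is $\chi_{\varepsilon t}$. Replacing each flow $\varphi^{b}_{b_j\varepsilon\tau}$ in $\psi_\tau$ by $\chi_{b_j\varepsilon\tau}$ gives the scheme $$\widetilde\psi_\tau=\varphi^{a}_{a_{s+1}\tau}\circ\chi_{b_s\varepsilon\tau}\circ\varphi^{a}_{a_s\tau}\circ\cdots\circ\chi_{b_1\varepsilon\tau}\circ\varphi^{a}_{a_1\tau}.$$ Then there are $C^\infty$ vector fields $d_1=f^{[b]},d_3,d_5,\dots$ on $\mathbb{R}^D$, with Lie operators $D_n g=d_n\cdot\nabla g$ (so that $D_1=B$ is the Lie operator of $f^{[b]}$), such that the series of differential operators corresponding to $\chi_h$ is $$\exp\bigl(hB+h^3D_3+h^5D_5+\cdots\bigr),$$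 i.e. for every $C^\infty$ function $g:\mathbb{R}^D\to\mathbb{R}$ and every $x$, the Taylor series of $h\mapsto g(\chi_h(x))$ at $h=0$ is this formal exponential applied to $g$ and evaluated at $x$; and for every $s$ and all coefficients $a_i,b_i$ the following hold. 1. The leading term of the difference between the two schemes is $\bigl(\sum_{j=1}^s b_j^3\bigr)\varepsilon^3\tau^3D_3$: for every $C^\infty$ function $g:\mathbb{R}^D\to\mathbb{R}$ and every $x$, $$g(\widetilde\psi_\tau(x))-g(\psi_\tau(x))=\Bigl(\sum_{j=1}^s b_j^3\Bigr)\varepsilon^3\tau^3\,(D_3g)(x)+\mathcal{O}(\varepsilon^3\tau^4)\quad\text{as }(\tau,\varepsilon)\to(0,0).$$ 2. If $\psi_\tau$ is symmetric and has generalized order $(r,4)$, then $\widetilde\psi_\tau$ has generalized order $(r,4,2)$. 3. If in addition $\sum_{i=1}^s b_i^3=0$, then $\widetilde\psi_\tau$ has generalized order $(r,4)$. -/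

import Mathlib

open Filter Topology Asymptotics
open scoped ContDiff

namespace SplittingFlow

/-- The phase space `ℝ^D`. -/
abbrev Phase (D : ℕ) : Type := EuclideanSpace ℝ (Fin D)

/-- Smooth (`C^∞`) vector fields on `ℝ^D`. -/
abbrev SmoothVectorField (D : ℕ) : Type := {v : Phase D → Phase D // ContDiff ℝ ∞ v}

/-- The vector space of smooth (`C^∞`) functions `g : ℝ^D → ℝ`. -/
def SmoothFun (D : ℕ) : Submodule ℝ (Phase D → ℝ) where
  carrier := {g | ContDiff ℝ ∞ g}
  zero_mem' := (contDiff_const : ContDiff ℝ ∞ fun _ : Phase D => (0 : ℝ))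
  add_mem' := fun {f g} (hf : ContDiff ℝ ∞ f) (hg : ContDiff ℝ ∞ g) => hf.add hg
  smul_mem' := fun c f (hf : ContDiff ℝ ∞ f) => (contDiff_const (c := c)).smul hf

theorem SmoothFun.contDiff {D : ℕ} (g : SmoothFun D) : ContDiff ℝ ∞ g.1 := g.2

theorem SmoothFun.differentiableAt {D : ℕ} (g : SmoothFun D) (x : Phase D) :
    DifferentiableAt ℝ g.1 x := (SmoothFun.contDiff g).differentiable (by norm_num) x

/-- `φ` is the local flow of the vector field `f`: near every point `x₀` and for small times `t`,
`t ↦ φ t x` is the solution of `x' = f x` with initial value `x`. Nothing is required of `φ` at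
times outside such a neighbourhood, so `f` need not be complete. -/
def IsLocalFlow {D : ℕ} (f : Phase D → Phase D) (φ : ℝ → Phase D → Phase D) : Prop :=
  ∀ x₀ : Phase D, ∀ᶠ p : ℝ × Phase D in 𝓝 (0, x₀),
    φ 0 p.2 = p.2 ∧ HasDerivAt (fun t => φ t p.2) (f (φ p.1 p.2)) p.1

/-- `φ ε τ` is the local flow at time `τ` of the perturbed system `x' = fa x + ε • fb x`,
for small `ε`, small `τ` and initial values near any given point. -/
def IsPerturbedFlow {D : ℕ} (fa fb : Phase D → Phase D) (φ : ℝ → ℝ → Phase D → Phase D) : Prop :=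
  ∀ x₀ : Phase D, ∀ᶠ p : ℝ × ℝ × Phase D in 𝓝 (0, 0, x₀),
    φ p.1 0 p.2.2 = p.2.2 ∧
    HasDerivAt (fun t => φ p.1 t p.2.2)
      (fa (φ p.1 p.2.1 p.2.2) + p.1 • fb (φ p.1 p.2.1 p.2.2)) p.2.1

/-- `χ h` is one step of size `h` of a smooth, symmetric (`χ (-h) = (χ h)⁻¹`) integrator, of order
two, for the system whose flow is `φ`. As for flows, everything is local around `h = 0`. -/
structure IsSymmetricSecondOrder {D : ℕ} (φ χ : ℝ → Phase D → Phase D) : Prop where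
  smooth : ∀ x : Phase D, ContDiffAt ℝ ∞ (fun p : ℝ × Phase D => χ p.1 p.2) (0, x)
  symm : ∀ x₀ : Phase D, ∀ᶠ p : ℝ × Phase D in 𝓝 (0, x₀), χ (-p.1) (χ p.1 p.2) = p.2
  order_two : ∀ x : Phase D, (fun h : ℝ => χ h x - φ h x) =O[𝓝 0] fun h : ℝ => h ^ 3

/-- The composition
`Φa (a_{s+1} τ) ∘ Φb (ε b_s τ) ∘ Φa (a_s τ) ∘ ⋯ ∘ Φb (ε b_1 τ) ∘ Φa (a_1 τ)`
(coefficients are indexed from `0` here). If `Φb` is the flow of `x' = fb x`, then `Φb (ε t)` is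
the flow at time `t` of `x' = ε • fb x`; likewise, if `Φb h` is one step of size `h` of an
integrator for `x' = fb x`, then `Φb (ε t)` is its step of size `t` for `x' = ε • fb x`. -/
def splitting {D : ℕ} (Φa Φb : ℝ → Phase D → Phase D) :
    (s : ℕ) → (Fin (s + 1) → ℝ) → (Fin s → ℝ) → ℝ → ℝ → Phase D → Phase D
  | 0, a, _, _, τ => Φa (a 0 * τ)
  | s + 1, a, b, ε, τ =>
      Φa (a (Fin.last (s + 1)) * τ) ∘ Φb (ε * (b (Fin.last s) * τ)) ∘
        splitting Φa Φb s (fun i => a i.castSucc) (fun i => b i.castSucc) ε τ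

/-- The composition with coefficients `a`, `b` is left-right palindromic. -/
def IsPalindromic {s : ℕ} (a : Fin (s + 1) → ℝ) (b : Fin s → ℝ) : Prop :=
  (∀ i, a i.rev = a i) ∧ ∀ i, b i.rev = b i

/-- The method `ψ` has generalized order `(r₁, …, r_m)`, `r₁ ≥ ⋯ ≥ r_m`, for the system with exact
flow `φ`: at every `x`, as `(ε, τ) → (0, 0)`, the local error `ψ - φ` is
`O(ε τ^(r₁+1) + ε² τ^(r₂+1) + ⋯ + ε^m τ^(r_m+1))`. Both maps are written with `ε` first. -/
def HasGeneralizedOrder {D : ℕ} (φ ψ : ℝ → ℝ → Phase D → Phase D) (r : List ℕ) : Prop :=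
  r.Pairwise (· ≥ ·) ∧
  ∀ x : Phase D,
    (fun p : ℝ × ℝ => ψ p.1 p.2 x - φ p.1 p.2 x) =O[𝓝 (0, 0)]
      fun p : ℝ × ℝ => ∑ j : Fin r.length, |p.1| ^ ((j : ℕ) + 1) * |p.2| ^ (r.get j + 1)

/-- The Lie operator `g ↦ v · ∇g` of a smooth vector field `v`, acting on smooth functions. -/
noncomputable def lieOp {D : ℕ} (v : SmoothVectorField D) : Module.End ℝ (SmoothFun D) where
  toFun g := ⟨fun x => fderiv ℝ g.1 x (v.1 x),
    ((SmoothFun.contDiff g).fderiv_right (m := ∞) (by norm_num)).clm_apply v.2⟩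
  map_add' g k := by
    ext x
    change fderiv ℝ (g.1 + k.1) x (v.1 x) = fderiv ℝ g.1 x (v.1 x) + fderiv ℝ k.1 x (v.1 x)
    rw [fderiv_add (SmoothFun.differentiableAt g x) (SmoothFun.differentiableAt k x)]
    rfl
  map_smul' c g := by
    ext x
    change fderiv ℝ (c • g.1) x (v.1 x) = c • fderiv ℝ g.1 x (v.1 x)
    rw [fderiv_const_smul (SmoothFun.differentiableAt g x)]
    rfl

/-- The formal exponential `∑ₘ Fᵐ / m!` of a power series `F` (in one central variable, with
coefficients in a possibly noncommutative algebra) with zero constant coefficient. Since `Fᵐ` then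
starts at degree `m`, only the terms `m ≤ k` contribute to the coefficient of degree `k`. -/
noncomputable def formalExp {R : Type*} [Ring R] [Algebra ℝ R] (F : PowerSeries R) :
    PowerSeries R :=
  PowerSeries.mk fun k =>
    ∑ m ∈ Finset.range (k + 1), ((m.factorial : ℝ)⁻¹) • PowerSeries.coeff k (F ^ m)

/-- The series `h D₁ + h³ D₃ + h⁵ D₅ + ⋯`, with `Dₙ` the Lie operator of the vector field
`d n`; only the `d n` with `n` odd are used. -/
noncomputable def oddLieSeries {D : ℕ} (d : ℕ → SmoothVectorField D) :
    PowerSeries (Module.End ℝ (SmoothFun D)) :=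
  PowerSeries.mk fun n => if Odd n then lieOp (d n) else 0

/-- The series of differential operators `S` corresponds to the one-parameter family of maps `χ`:
for each smooth `g`, the Taylor series at `h = 0` of `h ↦ g (χ h x)` is `(S g) x`. -/
def HasOperatorSeries {D : ℕ} (χ : ℝ → Phase D → Phase D)
    (S : PowerSeries (Module.End ℝ (SmoothFun D))) : Prop :=
  ∀ (g : SmoothFun D) (x : Phase D) (N : ℕ),
    (fun h : ℝ => g.1 (χ h x) -
        ∑ k ∈ Finset.range (N + 1), h ^ k * (PowerSeries.coeff k S g).1 x)
      =O[𝓝 0] fun h : ℝ => h ^ (N + 1)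

end SplittingFlow

/-! The fields `d n` come from backward error analysis. The Taylor coefficients `X k` of `h ↦ g (χ h
x)` are operators on smooth functions. Expanding products gives `X n (f g) = ∑ X i f * X j g` over
`i + j = n`, and `χ (-h) ∘ χ h = id` gives `∑ (-1)^j X i X j = 0` for `n ≠ 0`. The exponential of an
odd series of derivations has both properties (`formalExp_apply_bilinear`,
`sum_antidiagonal_formalExp_odd`). If such an exponential agrees with `X` below degree `n`, the
defect in degree `n` is therefore a derivation, hence a vector field by Hadamard's lemma
(`eq_lieOp_of_derivation`). For odd `n` it is absorbed into `d n`; for even `n` the symmetry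
relation makes it vanish (`exists_next_vectorField`). Comparison with the series `exp (hB)` of the
flow then yields `χ - φb = h³ d₃ + h⁴ e + O(h⁵)`, locally uniformly.

Induction over the factors propagates this through the composition: `ψ̃ - ψ = ε³τ³ ((∑ bⱼ³) d₃ + τ
v(ε, x)) + O(ε³τ⁵)` (`splitting_expansion`). The factor `ε³` survives in every remainder, because
differences arise only from `χ - φb` at steps proportional to `ετ`. This gives the leading term and
the order `(r, 4, 2)`.

If `∑ bⱼ³ = 0`, the difference is `ε³τ⁴ v + O(ε³τ⁵)`, one power of `τ` short. For palindromic
coefficients both schemes satisfy `ψ_{-τ} ∘ ψ_τ = id`; as `τ⁴` is even, comparing the two identities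
gives `2 ε³τ⁴ v = O(ε³τ⁵)` (`splitting_sub_splitting_isBigO_of_palindromic`). The difference is then
covered by the term `ε²τ⁵` of the order `(r, 4)`. -/

namespace SplittingFlow

/-! ### Taylor expansions locally uniform in a parameter. -/

section Asymptotics

variable {Y F : Type*} [TopologicalSpace Y] [NormedAddCommGroup F] [NormedSpace ℝ F]

/-- Integrating an asymptotic bound in the first variable, locally uniformly in a parameter. -/
theorem isBigO_of_hasDerivAt {u u' : ℝ × Y → F} {w : Y → ℝ} {y₀ : Y} {N : ℕ}
    (h0 : ∀ᶠ y in 𝓝 y₀, u (0, y) = 0)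
    (hd : ∀ᶠ p in 𝓝 ((0 : ℝ), y₀), HasDerivAt (fun t => u (t, p.2)) (u' p) p.1)
    (hb : u' =O[𝓝 ((0 : ℝ), y₀)] fun p => p.1 ^ N * w p.2) :
    u =O[𝓝 ((0 : ℝ), y₀)] fun p => p.1 ^ (N + 1) * w p.2 := by
  obtain ⟨C, hC0, hC⟩ := hb.exists_nonneg
  have h := hd.and hC.bound
  rw [nhds_prod_eq, eventually_prod_iff] at h
  obtain ⟨P, hP, Q, hQ, hPQ⟩ := h
  obtain ⟨δ, hδ, hball⟩ := Metric.eventually_nhds_iff.1 hP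
  refine IsBigO.of_bound C ?_
  rw [nhds_prod_eq, eventually_prod_iff]
  refine ⟨fun t => |t| < δ, ?_, fun y => Q y ∧ u (0, y) = 0, hQ.and h0, ?_⟩
  · filter_upwards [Metric.ball_mem_nhds (0 : ℝ) hδ] with t ht
    simpa using ht
  intro t ht y ⟨hy, hy0⟩
  have hs : ∀ s ∈ Set.uIcc 0 t, |s| ≤ |t| := fun s hs => by
    simpa using Set.abs_sub_left_of_mem_uIcc hs
  have hp : ∀ s ∈ Set.uIcc 0 t, P s := fun s h => hball (by simpa using (hs s h).trans_lt ht)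
  -- Mean value inequality on the segment between `0` and `t`, where `|s| ^ N ≤ |t| ^ N` bounds the
  -- derivative by a constant.
  have key := (convex_uIcc (0 : ℝ) t).norm_image_sub_le_of_norm_hasDerivWithin_le
    (f := fun s => u (s, y)) (f' := fun s => u' (s, y)) (C := C * (|t| ^ N * |w y|))
    (fun s h => (hPQ (hp s h) hy).1.hasDerivWithinAt) (fun s h => ?_)
    Set.left_mem_uIcc Set.right_mem_uIcc
  · simp only [hy0, sub_zero, Real.norm_eq_abs] at key
    refine key.trans (le_of_eq ?_)
    simp only [Real.norm_eq_abs, abs_mul, abs_pow]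
    ring
  · have h1 := (hPQ (hp s h) hy).2
    simp only [Real.norm_eq_abs, abs_mul, abs_pow] at h1
    refine h1.trans ?_
    have hw := abs_nonneg (w y)
    have hs' := hs s h
    gcongr

/-- Taylor's formula in the first variable, locally uniformly in a parameter. -/
theorem taylor_isBigO {w : Y → ℝ} {y₀ : Y} (N : ℕ) (u : ℕ → ℝ × Y → F)
    (hd : ∀ k ≤ N, ∀ᶠ p in 𝓝 ((0 : ℝ), y₀),
      HasDerivAt (fun t => u k (t, p.2)) (u (k + 1) p) p.1)
    (hb : u (N + 1) =O[𝓝 ((0 : ℝ), y₀)] fun p => w p.2) :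
    (fun p : ℝ × Y => u 0 p -
        ∑ k ∈ Finset.range (N + 1), (p.1 ^ k * ((k.factorial : ℝ)⁻¹)) • u k (0, p.2))
      =O[𝓝 ((0 : ℝ), y₀)] fun p => p.1 ^ (N + 1) * w p.2 := by
  induction N generalizing u with
  | zero =>
    refine isBigO_of_hasDerivAt (u' := u 1) (by simp) ?_ (by simpa using hb)
    filter_upwards [hd 0 le_rfl] with p hp
    simpa using hp.sub_const (u 0 (0, p.2))
  | succ N ih =>
    have h1 := ih (fun k => u (k + 1)) (fun k hk => hd (k + 1) (by omega)) hb
    refine isBigO_of_hasDerivAt (Eventually.of_forall fun y => ?_) ?_ h1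
    · rw [Finset.sum_eq_single 0] <;> simp +contextual
    · filter_upwards [hd 0 (by omega)] with p hp
      refine hp.sub ?_
      -- The derivative of the Taylor polynomial of `u` is that of the shifted family `u (k + 1)`,
      -- already controlled by `h1`.
      have : ∀ t : ℝ, ∑ k ∈ Finset.range (N + 1 + 1),
          (t ^ k * ((k.factorial : ℝ)⁻¹)) • u k (0, p.2) = ∑ k ∈ Finset.range (N + 1),
          (t ^ (k + 1) * (((k + 1).factorial : ℝ)⁻¹)) • u (k + 1) (0, p.2) + u 0 (0, p.2) := by
        intro t
        rw [Finset.sum_range_succ']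
        simp
      simp only [this]
      refine HasDerivAt.add_const _ (HasDerivAt.fun_sum fun k _ => HasDerivAt.smul_const ?_ _)
      have := (hasDerivAt_pow (k + 1) p.1).mul_const (((k + 1).factorial : ℝ)⁻¹)
      convert this using 1
      rw [Nat.factorial_succ]
      push_cast
      have : (k.factorial : ℝ) ≠ 0 := by positivity
      have : (k : ℝ) + 1 ≠ 0 := by positivity
      field_simp

end Asymptotics

/-- A polynomial which vanishes to an order larger than its degree is zero. -/
theorem coeff_eq_zero_of_isBigO (N : ℕ) (c : ℕ → ℝ)
    (h : (fun t : ℝ => ∑ k ∈ Finset.range (N + 1), t ^ k * c k) =O[𝓝[≠] 0]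
      fun t => t ^ (N + 1)) : ∀ k ≤ N, c k = 0 := by
  induction N generalizing c with
  | zero =>
    intro k hk
    obtain rfl : k = 0 := by omega
    have h1 : Tendsto (fun t : ℝ => ∑ k ∈ Finset.range (0 + 1), t ^ k * c k) (𝓝[≠] 0) (𝓝 0) := by
      refine h.trans_tendsto (tendsto_nhdsWithin_of_tendsto_nhds ?_)
      simpa using (continuous_pow (M := ℝ) 1).tendsto 0
    simp only [zero_add, Finset.range_one, Finset.sum_singleton, pow_zero, one_mul] at h1
    exact tendsto_nhds_unique tendsto_const_nhds h1
  | succ N ih =>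
    have h0 : c 0 = 0 := by
      have h1 : Tendsto (fun t : ℝ => ∑ k ∈ Finset.range (N + 1 + 1), t ^ k * c k)
          (𝓝[≠] 0) (𝓝 0) := by
        refine h.trans_tendsto (tendsto_nhdsWithin_of_tendsto_nhds ?_)
        simpa using (continuous_pow (M := ℝ) (N + 1 + 1)).tendsto 0
      have h2 : Tendsto (fun t : ℝ => ∑ k ∈ Finset.range (N + 1 + 1), t ^ k * c k)
          (𝓝[≠] 0) (𝓝 (c 0)) := by
        refine tendsto_nhdsWithin_of_tendsto_nhds ?_
        have : Continuous fun t : ℝ => ∑ k ∈ Finset.range (N + 1 + 1), t ^ k * c k := by fun_prop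
        have h3 := this.tendsto 0
        rw [Finset.sum_eq_single 0 (by simp +contextual) (by simp)] at h3
        simpa using h3
      exact tendsto_nhds_unique h2 h1
    have h1 := ih (fun k => c (k + 1)) ?_
    · intro k hk
      rcases k with _ | k
      · exact h0
      · exact h1 k (by omega)
    -- As `c 0 = 0`, the sum is divisible by `t`; the punctured neighbourhood permits the division.
    · have h2 : (fun t : ℝ => t⁻¹) =O[𝓝[≠] (0 : ℝ)] fun t => t⁻¹ := isBigO_refl _ _
      refine (h2.mul h).congr' ?_ ?_
      · filter_upwards [self_mem_nhdsWithin] with t ht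
        have ht : t ≠ 0 := ht
        rw [Finset.sum_range_succ', h0, mul_zero, add_zero, Finset.mul_sum]
        refine Finset.sum_congr rfl fun k _ => ?_
        field_simp
        ring
      · filter_upwards [self_mem_nhdsWithin] with t ht
        have ht : t ≠ 0 := ht
        field_simp
        ring

end SplittingFlow

/-! ### Local flows: continuity, Lipschitz dependence, reversibility, short-time expansions. -/

namespace SplittingFlow

variable {D : ℕ}

/-- Boxes form a basis of the neighbourhoods of `(0, y)`. -/
theorem exists_box_of_eventually {Y : Type*} [TopologicalSpace Y] {y : Y} {P : ℝ × Y → Prop}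
    (h : ∀ᶠ p in 𝓝 ((0 : ℝ), y), P p) :
    ∃ δ > 0, ∀ᶠ z in 𝓝 y, ∀ t : ℝ, |t| < δ → P (t, z) := by
  rw [nhds_prod_eq, eventually_prod_iff] at h
  obtain ⟨A, hA, B, hB, hAB⟩ := h
  obtain ⟨δ, hδ, hball⟩ := Metric.eventually_nhds_iff.1 hA
  exact ⟨δ, hδ, hB.mono fun z hz t ht => hAB (hball (by simpa using ht)) hz⟩

theorem eventually_of_box {Y : Type*} [TopologicalSpace Y] {y : Y} {P : ℝ × Y → Prop} {δ : ℝ}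
    (hδ : 0 < δ) (h : ∀ᶠ z in 𝓝 y, ∀ t : ℝ, |t| < δ → P (t, z)) :
    ∀ᶠ p in 𝓝 ((0 : ℝ), y), P p := by
  rw [nhds_prod_eq, eventually_prod_iff]
  refine ⟨fun t => |t| < δ, ?_, _, h, fun ht _ hz => hz _ ht⟩
  filter_upwards [Metric.ball_mem_nhds (0 : ℝ) hδ] with t ht
  simpa using ht

theorem tendsto_neg_fst {Y : Type*} [TopologicalSpace Y] (y : Y) :
    Tendsto (fun p : ℝ × Y => (-p.1, p.2)) (𝓝 (0, y)) (𝓝 (0, y)) := by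
  have : Continuous fun p : ℝ × Y => (-p.1, p.2) := by fun_prop
  simpa using this.tendsto (0, y)

/-- A property near time `0` holds if it holds at nonnegative and at nonpositive times. -/
theorem eventually_of_nonneg_of_nonpos {Y : Type*} [TopologicalSpace Y] {y : Y}
    {P : ℝ × Y → Prop} (h1 : ∀ᶠ p in 𝓝 ((0 : ℝ), y), 0 ≤ p.1 → P p)
    (h2 : ∀ᶠ p in 𝓝 ((0 : ℝ), y), 0 ≤ p.1 → P (-p.1, p.2)) :
    ∀ᶠ p in 𝓝 ((0 : ℝ), y), P p := by
  filter_upwards [h1, (tendsto_neg_fst y).eventually h2] with p hp hn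
  rcases le_total 0 p.1 with h | h
  · exact hp h
  · simpa using hn (by simpa using h)

section Flow

variable {f : Phase D → Phase D} {φ : ℝ → Phase D → Phase D}

/-- Reduces negative times to nonnegative ones: the estimates below are proved for `0 ≤ t` and then
applied to the reversed flow. -/
theorem IsLocalFlow.reverse (h : IsLocalFlow f φ) :
    IsLocalFlow (fun x => -f x) fun t => φ (-t) := fun x₀ => by
  filter_upwards [(tendsto_neg_fst x₀).eventually (h x₀)] with p hp
  refine ⟨by simpa using hp.1, ?_⟩
  have := hp.2.scomp p.1 (hasDerivAt_neg p.1)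
  simpa [Function.comp_def] using this

/-- `IsLocalFlow` assumes no continuity in the initial value; this a priori bound supplies it. While
a solution stays in a ball where `‖f‖ < M`, its speed is below `M`, so it cannot leave the ball in a
short time. -/
theorem IsLocalFlow.tendsto_nonneg (h : IsLocalFlow f φ) (hf : Continuous f) (x₀ : Phase D)
    {ρ : ℝ} (hρ : 0 < ρ) :
    ∀ᶠ p in 𝓝 ((0 : ℝ), x₀), 0 ≤ p.1 → ‖φ p.1 p.2 - x₀‖ < ρ := by
  set M := ‖f x₀‖ + 1 with hM
  have hM0 : 0 < M := by positivity
  have hfM : ∀ᶠ x in 𝓝 x₀, ‖f x‖ < M :=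
    hf.norm.continuousAt.eventually_lt continuousAt_const (by simp [hM])
  obtain ⟨σ, hσ, hball⟩ := Metric.eventually_nhds_iff.1 hfM
  obtain ⟨δ, hδ, hQ⟩ := exists_box_of_eventually (h x₀)
  set r := min σ ρ with hr
  have hr0 : 0 < r := lt_min hσ hρ
  -- Starting within `r / 4` of `x₀` and moving by at most `M * t < r / 2`, a solution stays within
  -- `3 * r / 4`.
  refine eventually_of_box (δ := min δ (r / (2 * M))) (by positivity) ?_
  filter_upwards [hQ, Metric.ball_mem_nhds x₀ (show 0 < r / 4 by positivity)] with y hy hy4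
  intro t ht ht0
  rw [abs_of_nonneg ht0] at ht
  have htδ := ht.trans_le (min_le_left _ _)
  have htM : M * t < r / 2 := by
    have := ht.trans_le (min_le_right _ _)
    rw [lt_div_iff₀ (by positivity)] at this
    linarith
  have hd : ∀ s ∈ Set.Icc 0 t, HasDerivAt (fun s => φ s y - x₀) (f (φ s y)) s := fun s hs =>
    ((hy s (by rw [abs_of_nonneg hs.1]; exact hs.2.trans_lt htδ)).2).sub_const x₀
  have h0 := (hy 0 (by simpa using hδ)).1
  -- The speed bound is needed only where the distance meets the barrier `r / 4 + M * s`, hence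
  -- inside the ball of radius `σ`.
  have key := image_norm_le_of_norm_deriv_right_lt_deriv_boundary
    (f := fun s => φ s y - x₀) (f' := fun s => f (φ s y)) (a := 0) (b := t)
    (B := fun s => r / 4 + M * s) (B' := fun _ => M)
    (fun s hs => (hd s hs).continuousAt.continuousWithinAt)
    (fun s hs => (hd s (Set.Ico_subset_Icc_self hs)).hasDerivWithinAt)
    (by
      rw [h0]
      simpa [dist_eq_norm] using (Metric.mem_ball.1 hy4).le)
    (fun s => by simpa using ((hasDerivAt_id s).const_mul M).const_add (r / 4))
    (fun s hs hB => hball (by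
      rw [dist_eq_norm, hB]
      have : M * s ≤ M * t := by gcongr; exact hs.2.le
      have := min_le_left σ ρ
      linarith)) (Set.right_mem_Icc.2 ht0)
  have := min_le_right σ ρ
  change ‖φ t y - x₀‖ < ρ
  linarith

theorem IsLocalFlow.tendsto (h : IsLocalFlow f φ) (hf : Continuous f) (x₀ : Phase D) :
    Tendsto (fun p : ℝ × Phase D => φ p.1 p.2) (𝓝 (0, x₀)) (𝓝 x₀) := by
  refine Metric.tendsto_nhds.2 fun ρ hρ => ?_
  simp only [dist_eq_norm]
  exact eventually_of_nonneg_of_nonpos (h.tendsto_nonneg hf x₀ hρ)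
    (h.reverse.tendsto_nonneg hf.neg x₀ hρ)

theorem tendsto_fst_pair (x₀ : Phase D) :
    Tendsto (fun p : ℝ × Phase D × Phase D => (p.1, p.2.1)) (𝓝 (0, x₀, x₀)) (𝓝 (0, x₀)) :=
  (continuous_fst.prodMk continuous_snd.fst).tendsto (0, x₀, x₀)

theorem tendsto_snd_pair (x₀ : Phase D) :
    Tendsto (fun p : ℝ × Phase D × Phase D => (p.1, p.2.2)) (𝓝 (0, x₀, x₀)) (𝓝 (0, x₀)) :=
  (continuous_fst.prodMk continuous_snd.snd).tendsto (0, x₀, x₀)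

/-- Grönwall's inequality where `f` is Lipschitz; capping the time at `1` makes the factor `exp (K *
t)` uniform. -/
theorem IsLocalFlow.dist_le_nonneg (h : IsLocalFlow f φ) (hf : ContDiff ℝ 1 f) (x₀ : Phase D) :
    ∃ C : ℝ, ∀ᶠ p in 𝓝 ((0 : ℝ), x₀, x₀), 0 ≤ p.1 →
      ‖φ p.1 p.2.1 - φ p.1 p.2.2‖ ≤ C * ‖p.2.1 - p.2.2‖ := by
  obtain ⟨K, S, hS, hK⟩ := hf.contDiffAt.exists_lipschitzOnWith (x := x₀)
  have hflow := (h x₀).and ((h.tendsto hf.continuous x₀).eventually hS)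
  obtain ⟨δ, hδ, hQ⟩ := exists_box_of_eventually hflow
  refine ⟨Real.exp (K * 1), eventually_of_box (δ := min δ 1) (by positivity) ?_⟩
  rw [nhds_prod_eq]
  filter_upwards [hQ.prod_mk hQ] with q ⟨hu, hv⟩ t ht ht0
  rw [abs_of_nonneg ht0] at ht
  have htδ : ∀ s ∈ Set.Icc 0 t, |s| < δ := fun s hs => by
    rw [abs_of_nonneg hs.1]
    exact hs.2.trans_lt (ht.trans_le (min_le_left _ _))
  have ht1 := ht.trans_le (min_le_right _ _)
  have hsub : ∀ s ∈ Set.Ico 0 t, |s| < δ := fun s hs => htδ s (Set.Ico_subset_Icc_self hs)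
  have key := dist_le_of_trajectories_ODE_of_mem (v := fun _ => f) (s := fun _ => S) (K := K)
    (f := fun s => φ s q.1) (g := fun s => φ s q.2) (a := 0) (b := t) (δ := ‖q.1 - q.2‖)
    (fun _ _ => hK)
    (fun s hs => (hu s (htδ s hs)).1.2.continuousAt.continuousWithinAt)
    (fun s hs => (hu s (hsub s hs)).1.2.hasDerivWithinAt)
    (fun s hs => (hu s (hsub s hs)).2)
    (fun s hs => (hv s (htδ s hs)).1.2.continuousAt.continuousWithinAt)
    (fun s hs => (hv s (hsub s hs)).1.2.hasDerivWithinAt)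
    (fun s hs => (hv s (hsub s hs)).2)
    (by
      have h1 := (hu 0 (by simpa using hδ)).1.1
      have h2 := (hv 0 (by simpa using hδ)).1.1
      rw [h1, h2, dist_eq_norm]) t (Set.right_mem_Icc.2 ht0)
  rw [dist_eq_norm] at key
  refine key.trans ?_
  rw [mul_comm]
  gcongr
  linarith

/-- The local flow depends on the initial value in a locally Lipschitz way. -/
theorem IsLocalFlow.isBigO_sub (h : IsLocalFlow f φ) (hf : ContDiff ℝ 1 f) (x₀ : Phase D) :
    (fun p : ℝ × Phase D × Phase D => φ p.1 p.2.1 - φ p.1 p.2.2)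
      =O[𝓝 (0, x₀, x₀)] fun p => ‖p.2.1 - p.2.2‖ := by
  obtain ⟨C, hC⟩ := h.dist_le_nonneg hf x₀
  obtain ⟨C', hC'⟩ := h.reverse.dist_le_nonneg hf.neg x₀
  refine IsBigO.of_bound (max C C') (eventually_of_nonneg_of_nonpos ?_ ?_)
  · filter_upwards [hC] with p hp h0
    rw [norm_norm]
    exact (hp h0).trans (by gcongr; exact le_max_left _ _)
  · filter_upwards [hC'] with p hp h0
    rw [norm_norm]
    exact (hp h0).trans (by gcongr; exact le_max_right _ _)

/-- Uniqueness for `x' = -f x`: both `s ↦ φ (-s) (φ t x)` and `s ↦ φ (t - s) x` solve it with value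
`φ t x` at `s = 0`, and at `s = t` the second one equals `x`. -/
theorem IsLocalFlow.symm_nonneg (h : IsLocalFlow f φ) (hf : ContDiff ℝ 1 f) (x₀ : Phase D) :
    ∀ᶠ p in 𝓝 ((0 : ℝ), x₀), 0 ≤ p.1 → φ (-p.1) (φ p.1 p.2) = p.2 := by
  obtain ⟨K, S, hS, hK⟩ := hf.contDiffAt.exists_lipschitzOnWith (x := x₀)
  have hflow := (h x₀).and ((h.tendsto hf.continuous x₀).eventually hS)
  obtain ⟨δ, hδ, hQ⟩ := exists_box_of_eventually hflow
  have h1 : ∀ᶠ p in 𝓝 ((0 : ℝ), x₀), (∀ t : ℝ, |t| < δ → (φ 0 p.2 = p.2 ∧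
      HasDerivAt (fun t => φ t p.2) (f (φ t p.2)) t) ∧ φ t p.2 ∈ S) :=
    (continuous_snd.tendsto ((0 : ℝ), x₀)).eventually hQ
  -- By continuity `φ t x` is also near `x₀`, so the trajectory starting there is controlled for all
  -- times below the same `δ`.
  have h2 := (h.tendsto hf.continuous x₀).eventually hQ
  have h3 : ∀ᶠ p in 𝓝 ((0 : ℝ), x₀), |p.1| < δ := by
    have : Continuous fun p : ℝ × Phase D => |p.1| := by fun_prop
    exact this.continuousAt.eventually_lt continuousAt_const (by simpa using hδ)
  filter_upwards [h1, h2, h3] with p hp hpt ht ht0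
  obtain ⟨t, x⟩ := p
  simp only at hp hpt ht ht0 ⊢
  rw [abs_of_nonneg ht0] at ht
  have hneg : ∀ s ∈ Set.Icc 0 t, |(-s)| < δ := fun s hs => by
    rw [abs_neg, abs_of_nonneg hs.1]
    exact hs.2.trans_lt ht
  have hsub : ∀ s ∈ Set.Icc 0 t, |t - s| < δ := fun s hs => by
    rw [abs_of_nonneg (by linarith [hs.2])]
    linarith [hs.1]
  have d1 : ∀ s ∈ Set.Icc 0 t, HasDerivAt (fun s => φ (-s) (φ t x)) (-f (φ (-s) (φ t x))) s :=
    fun s hs => by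
      have := (hpt (-s) (hneg s hs)).1.2.scomp s (hasDerivAt_neg s)
      simpa [Function.comp_def] using this
  have d2 : ∀ s ∈ Set.Icc 0 t, HasDerivAt (fun s => φ (t - s) x) (-f (φ (t - s) x)) s :=
    fun s hs => by
      have := (hp (t - s) (hsub s hs)).1.2.scomp s ((hasDerivAt_id s).const_sub t)
      simpa [Function.comp_def] using this
  have key := dist_le_of_trajectories_ODE_of_mem (v := fun _ x => -f x) (s := fun _ => S) (K := K)
    (f := fun s => φ (-s) (φ t x)) (g := fun s => φ (t - s) x) (a := 0) (b := t) (δ := 0)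
    (fun _ _ => hK.neg)
    (fun s hs => (d1 s hs).continuousAt.continuousWithinAt)
    (fun s hs => (d1 s (Set.Ico_subset_Icc_self hs)).hasDerivWithinAt)
    (fun s hs => (hpt (-s) (hneg s (Set.Ico_subset_Icc_self hs))).2)
    (fun s hs => (d2 s hs).continuousAt.continuousWithinAt)
    (fun s hs => (d2 s (Set.Ico_subset_Icc_self hs)).hasDerivWithinAt)
    (fun s hs => (hp (t - s) (hsub s (Set.Ico_subset_Icc_self hs))).2)
    (by
      have := (hpt 0 (by simpa using hδ)).1.1
      simp [this]) t (Set.right_mem_Icc.2 ht0)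
  have h0 := (hp 0 (by simpa using hδ)).1.1
  rw [zero_mul, sub_self, h0] at key
  exact dist_le_zero.1 key

theorem IsLocalFlow.symm (h : IsLocalFlow f φ) (hf : ContDiff ℝ 1 f) (x₀ : Phase D) :
    ∀ᶠ p in 𝓝 ((0 : ℝ), x₀), φ (-p.1) (φ p.1 p.2) = p.2 :=
  eventually_of_nonneg_of_nonpos (h.symm_nonneg hf x₀) (h.reverse.symm_nonneg hf.neg x₀)

/-- The derivative of an observable along a local flow. -/
theorem IsLocalFlow.hasDerivAt_comp {F : Type*} [NormedAddCommGroup F] [NormedSpace ℝ F]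
    (h : IsLocalFlow f φ) {g : Phase D → F} (hg : Differentiable ℝ g) (x₀ : Phase D) :
    ∀ᶠ p in 𝓝 ((0 : ℝ), x₀), HasDerivAt (fun t => g (φ t p.2))
      (fderiv ℝ g (φ p.1 p.2) (f (φ p.1 p.2))) p.1 := by
  filter_upwards [h x₀] with p hp
  exact (hg _).hasFDerivAt.comp_hasDerivAt p.1 hp.2

theorem isBigO_sub_of_contDiff {E F : Type*} [NormedAddCommGroup E] [NormedSpace ℝ E]
    [NormedAddCommGroup F] [NormedSpace ℝ F] {g : E → F} (hg : ContDiff ℝ 1 g) (x₀ : E) :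
    (fun q : E × E => g q.1 - g q.2) =O[𝓝 (x₀, x₀)] fun q => q.1 - q.2 :=
  (hg.contDiffAt.hasStrictFDerivAt (by norm_num)).isBigO_sub

/-- Second order expansion of the increments of a local flow. -/
theorem IsLocalFlow.isBigO_increment (h : IsLocalFlow f φ) (hf : ContDiff ℝ ∞ f)
    (x₀ : Phase D) :
    (fun p : ℝ × Phase D × Phase D => φ p.1 p.2.1 - φ p.1 p.2.2 - (p.2.1 - p.2.2)
      - p.1 • (f p.2.1 - f p.2.2)) =O[𝓝 (0, x₀, x₀)] fun p => p.1 ^ 2 * ‖p.2.1 - p.2.2‖ := by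
  have hf1 : ContDiff ℝ 1 f := hf.of_le (by exact_mod_cast le_top)
  have hf' : ContDiff ℝ 1 fun x => fderiv ℝ f x (f x) :=
    ((hf.fderiv_right (m := ∞) (by norm_num)).clm_apply hf).of_le (by exact_mod_cast le_top)
  have hdf := hf1.differentiable (by norm_num)
  -- Successive time derivatives of the increment. The second one is again the increment of a `C^1`
  -- function, hence bounded by the initial distance through Lipschitz dependence.
  let u : ℕ → ℝ × Phase D × Phase D → Phase D := fun k p => match k with
    | 0 => φ p.1 p.2.1 - φ p.1 p.2.2
    | 1 => f (φ p.1 p.2.1) - f (φ p.1 p.2.2)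
    | _ => fderiv ℝ f (φ p.1 p.2.1) (f (φ p.1 p.2.1)) -
      fderiv ℝ f (φ p.1 p.2.2) (f (φ p.1 p.2.2))
  have htend : Tendsto (fun p : ℝ × Phase D × Phase D => (φ p.1 p.2.1, φ p.1 p.2.2))
      (𝓝 (0, x₀, x₀)) (𝓝 (x₀, x₀)) :=
    ((h.tendsto hf.continuous x₀).comp (tendsto_fst_pair x₀)).prodMk_nhds
      ((h.tendsto hf.continuous x₀).comp (tendsto_snd_pair x₀))
  have key := taylor_isBigO (y₀ := (x₀, x₀)) (w := fun q => ‖q.1 - q.2‖) 1 u ?_ ?_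
  · refine key.congr' ?_ EventuallyEq.rfl
    have e1 := ((continuous_const (y := (0 : ℝ))).prodMk continuous_snd.fst).tendsto
      ((0 : ℝ), x₀, x₀) |>.eventually (h x₀)
    have e2 := ((continuous_const (y := (0 : ℝ))).prodMk continuous_snd.snd).tendsto
      ((0 : ℝ), x₀, x₀) |>.eventually (h x₀)
    filter_upwards [e1, e2] with p h1 h2
    have h1 := h1.1
    have h2 := h2.1
    simp [u, Finset.sum_range_succ, h1, h2, sub_sub, add_assoc]
  · intro k hk
    have a1 := (tendsto_fst_pair x₀).eventually (h x₀)
    have a2 := (tendsto_snd_pair x₀).eventually (h x₀)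
    have b1 := (tendsto_fst_pair x₀).eventually (h.hasDerivAt_comp hdf x₀)
    have b2 := (tendsto_snd_pair x₀).eventually (h.hasDerivAt_comp hdf x₀)
    filter_upwards [a1, a2, b1, b2] with p a1 a2 b1 b2
    interval_cases k
    · exact a1.2.sub a2.2
    · exact b1.sub b2
  · exact ((isBigO_sub_of_contDiff hf' x₀).comp_tendsto htend).trans
      (h.isBigO_sub hf1 x₀)

/-- Second order expansion of a local flow. -/
theorem IsLocalFlow.isBigO_taylor_one (h : IsLocalFlow f φ) (hf : ContDiff ℝ ∞ f)
    (x₀ : Phase D) :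
    (fun p : ℝ × Phase D => φ p.1 p.2 - p.2 - p.1 • f p.2)
      =O[𝓝 (0, x₀)] fun p => p.1 ^ 2 := by
  have hf1 : ContDiff ℝ 1 f := hf.of_le (by exact_mod_cast le_top)
  have hf' : Continuous fun x => fderiv ℝ f x (f x) :=
    (hf.continuous_fderiv (by simp)).clm_apply hf.continuous
  have hdf := hf1.differentiable (by norm_num)
  let u : ℕ → ℝ × Phase D → Phase D := fun k p => match k with
    | 0 => φ p.1 p.2
    | 1 => f (φ p.1 p.2)
    | _ => fderiv ℝ f (φ p.1 p.2) (f (φ p.1 p.2))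
  have key := taylor_isBigO (y₀ := x₀) (w := fun _ => 1) 1 u ?_ ?_
  · simp only [mul_one] at key
    refine key.congr' ?_ EventuallyEq.rfl
    have e1 := ((continuous_const (y := (0 : ℝ))).prodMk continuous_snd).tendsto
      ((0 : ℝ), x₀) |>.eventually (h x₀)
    filter_upwards [e1] with p h1
    have h1 := h1.1
    simp [u, Finset.sum_range_succ, h1, sub_sub]
  · intro k hk
    filter_upwards [h x₀, h.hasDerivAt_comp hdf x₀] with p a b
    interval_cases k
    · exact a.2
    · exact b
  · exact ((hf'.tendsto x₀).comp (h.tendsto hf.continuous x₀)).isBigO_one ℝ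

end Flow

end SplittingFlow

/-! ### Orders in `ε` and `τ`, and the effect of a single substep. -/

namespace SplittingFlow

/-- The first order Taylor formula for increments, locally uniformly in the base point. -/
theorem isBigO_sub_sub_fderiv {E F : Type*} [NormedAddCommGroup E] [NormedSpace ℝ E]
    [NormedAddCommGroup F] [NormedSpace ℝ F] {g : E → F} (hg : ContDiff ℝ ∞ g) (x₀ : E) :
    (fun q : E × E × E => g q.1 - g q.2.1 - fderiv ℝ g q.2.2 (q.1 - q.2.1))
      =O[𝓝 (x₀, x₀, x₀)] fun q => (‖q.1 - q.2.2‖ + ‖q.2.1 - q.2.2‖) * ‖q.1 - q.2.1‖ := by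
  have hg' : ContDiff ℝ 1 (fderiv ℝ g) :=
    (hg.fderiv_right (m := ∞) (by norm_num)).of_le (by exact_mod_cast le_top)
  have hd := hg.differentiable (by simp)
  obtain ⟨K, S, hS, hK⟩ := hg'.contDiffAt.exists_lipschitzOnWith (x := x₀)
  obtain ⟨r, hr, hball⟩ := Metric.mem_nhds_iff.1 hS
  have hb := Metric.ball_mem_nhds x₀ hr
  refine IsBigO.of_bound K ?_
  rw [nhds_prod_eq, nhds_prod_eq]
  filter_upwards [prod_mem_prod hb (prod_mem_prod hb hb)] with q ⟨hu, hv, hx⟩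
  obtain ⟨u, v, x⟩ := q
  simp only at hu hv hx ⊢
  have hseg : segment ℝ v u ⊆ Metric.ball x₀ r := (convex_ball x₀ r).segment_subset hv hu
  set ρ := ‖u - x‖ + ‖v - x‖ with hρ
  have hseg' : segment ℝ v u ⊆ Metric.closedBall x ρ := by
    refine (convex_closedBall x ρ).segment_subset ?_ ?_ <;>
      simp [dist_eq_norm, hρ]
  -- Mean value inequality for `g` minus its linearization at `x`: along the segment the derivative
  -- differs from the one at `x` by at most `K * ρ`.
  have key := (convex_segment v u).norm_image_sub_le_of_norm_hasFDerivWithin_le'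
    (f := g) (f' := fun z => fderiv ℝ g z) (φ := fderiv ℝ g x) (C := K * ρ)
    (fun z _ => (hd z).hasFDerivAt.hasFDerivWithinAt)
    (fun z hz => ((hK.norm_sub_le (hball (hseg hz)) (hball hx)).trans (by
      gcongr
      simpa [dist_eq_norm] using hseg' hz)))
    (left_mem_segment ℝ v u) (right_mem_segment ℝ v u)
  refine key.trans (le_of_eq ?_)
  rw [Real.norm_of_nonneg (by positivity)]
  ring

section Monomials

variable {E : Type*}

/-- The monomial `ε ^ i * τ ^ j`, as a function of `(ε, τ, x)`. -/
def monomial (E : Type*) (i j : ℕ) : ℝ × ℝ × E → ℝ := fun p => p.1 ^ i * p.2.1 ^ j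

variable [TopologicalSpace E] {x₀ : E}

theorem monomial_isBigO {i j k l : ℕ} (hik : k ≤ i) (hjl : l ≤ j) :
    monomial E i j =O[𝓝 (0, 0, x₀)] monomial E k l := by
  refine IsBigO.of_bound 1 ?_
  have h1 : ∀ᶠ p : ℝ × ℝ × E in 𝓝 (0, 0, x₀), |p.1| < 1 := by
    have : Continuous fun p : ℝ × ℝ × E => |p.1| := by fun_prop
    exact this.continuousAt.eventually_lt continuousAt_const (by simp)
  have h2 : ∀ᶠ p : ℝ × ℝ × E in 𝓝 (0, 0, x₀), |p.2.1| < 1 := by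
    have : Continuous fun p : ℝ × ℝ × E => |p.2.1| := by fun_prop
    exact this.continuousAt.eventually_lt continuousAt_const (by simp)
  filter_upwards [h1, h2] with p h1 h2
  simp only [monomial, norm_mul, norm_pow, Real.norm_eq_abs, one_mul]
  exact mul_le_mul (pow_le_pow_of_le_one (abs_nonneg _) h1.le hik)
    (pow_le_pow_of_le_one (abs_nonneg _) h2.le hjl) (by positivity) (by positivity)

variable {F : Type*} [NormedAddCommGroup F]

theorem _root_.Asymptotics.IsBigO.weaken {g : ℝ × ℝ × E → F} {i j k l : ℕ}
    (h : g =O[𝓝 (0, 0, x₀)] monomial E i j) (hik : k ≤ i) (hjl : l ≤ j) :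
    g =O[𝓝 (0, 0, x₀)] monomial E k l :=
  h.trans (monomial_isBigO hik hjl)

theorem isBigO_monomial_zero_of_continuous {g : ℝ × ℝ × E → F} (hg : Continuous g) :
    g =O[𝓝 (0, 0, x₀)] monomial E 0 0 := by
  have := (hg.tendsto ((0 : ℝ), (0 : ℝ), x₀)).isBigO_one ℝ
  refine this.congr_right fun p => ?_
  simp [monomial]

variable [NormedSpace ℝ F]

theorem _root_.Asymptotics.IsBigO.monomial_smul {c : ℝ × ℝ × E → ℝ} {g : ℝ × ℝ × E → F} {i j k l m n : ℕ}
    (hc : c =O[𝓝 (0, 0, x₀)] monomial E i j) (hg : g =O[𝓝 (0, 0, x₀)] monomial E k l)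
    (hm : m ≤ i + k) (hn : n ≤ j + l) :
    (fun p => c p • g p) =O[𝓝 (0, 0, x₀)] monomial E m n := by
  refine IsBigO.trans ?_ (monomial_isBigO hm hn)
  refine (hc.smul hg).congr_right fun p => ?_
  simp only [monomial, smul_eq_mul]
  ring

theorem isBigO_monomial_self (i j : ℕ) :
    (fun p : ℝ × ℝ × E => p.1 ^ i * p.2.1 ^ j) =O[𝓝 (0, 0, x₀)] monomial E i j :=
  isBigO_refl _ _

theorem isBigO_monomial_time {κ : ℝ → ℝ} (hκ : Continuous κ) :
    (fun p : ℝ × ℝ × E => κ p.1 * p.2.1) =O[𝓝 (0, 0, x₀)] monomial E 0 1 := by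
  have h1 : (fun p : ℝ × ℝ × E => κ p.1) =O[𝓝 (0, 0, x₀)] monomial E 0 0 :=
    isBigO_monomial_zero_of_continuous (by fun_prop)
  have h2 : (fun p : ℝ × ℝ × E => p.2.1) =O[𝓝 (0, 0, x₀)] monomial E 0 1 :=
    (isBigO_monomial_self 0 1).congr_left fun p => by simp
  exact h1.monomial_smul h2 le_rfl le_rfl

theorem _root_.Asymptotics.IsBigO.monomial_clm_apply {G : Type*} [NormedAddCommGroup G]
    [NormedSpace ℝ G] {A : E → F →L[ℝ] G} (hA : Continuous A) {g : ℝ × ℝ × E → F} {i j : ℕ}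
    (hg : g =O[𝓝 (0, 0, x₀)] monomial E i j) :
    (fun p => A p.2.2 (g p)) =O[𝓝 (0, 0, x₀)] monomial E i j := by
  have h0 : (fun p : ℝ × ℝ × E => ‖A p.2.2‖) =O[𝓝 (0, 0, x₀)] monomial E 0 0 :=
    isBigO_monomial_zero_of_continuous (by fun_prop)
  have h1 := h0.monomial_smul hg.norm_left (m := i) (n := j) (by simp) (by simp)
  refine IsBigO.trans (IsBigO.of_bound 1 (Eventually.of_forall fun p => ?_)) h1
  rw [one_mul, smul_eq_mul, norm_mul, norm_norm, norm_norm]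
  exact (A p.2.2).le_opNorm _

theorem tendsto_time {κ : ℝ → ℝ} (hκ : Continuous κ) :
    Tendsto (fun p : ℝ × ℝ × E => κ p.1 * p.2.1) (𝓝 (0, 0, x₀)) (𝓝 0) := by
  have : Continuous fun p : ℝ × ℝ × E => κ p.1 * p.2.1 := by fun_prop
  simpa using this.tendsto (0, 0, x₀)

end Monomials

variable {D : ℕ}

theorem tendsto_of_isBigO_sub {Ψ : ℝ × ℝ × Phase D → Phase D} {x₀ : Phase D}
    (h : (fun p => Ψ p - p.2.2) =O[𝓝 (0, 0, x₀)] monomial (Phase D) 0 1) :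
    Tendsto Ψ (𝓝 (0, 0, x₀)) (𝓝 x₀) := by
  have h0 : Tendsto (monomial (Phase D) 0 1) (𝓝 (0, 0, x₀)) (𝓝 0) := by
    have : Continuous (monomial (Phase D) 0 1) := by unfold monomial; fun_prop
    simpa [monomial] using this.tendsto (0, 0, x₀)
  have h1 := h.trans_tendsto h0
  have h2 : Tendsto (fun p : ℝ × ℝ × Phase D => p.2.2) (𝓝 (0, 0, x₀)) (𝓝 x₀) :=
    (continuous_snd.snd).tendsto (0, 0, x₀)
  simpa using h1.add h2

theorem isBigO_sub_of_expansion {Ψ : ℝ × ℝ × Phase D → Phase D} {m : ℝ × Phase D → Phase D}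
    {x₀ : Phase D} (hm : Continuous m)
    (h : (fun p => Ψ p - p.2.2 - p.2.1 • m (p.1, p.2.2))
      =O[𝓝 (0, 0, x₀)] monomial (Phase D) 0 2) :
    (fun p => Ψ p - p.2.2) =O[𝓝 (0, 0, x₀)] monomial (Phase D) 0 1 := by
  have h1 : (fun p : ℝ × ℝ × Phase D => p.2.1) =O[𝓝 (0, 0, x₀)] monomial (Phase D) 0 1 :=
    (isBigO_monomial_self 0 1).congr_left fun p => by simp
  have h2 : (fun p : ℝ × ℝ × Phase D => m (p.1, p.2.2))
      =O[𝓝 (0, 0, x₀)] monomial (Phase D) 0 0 :=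
    isBigO_monomial_zero_of_continuous (by fun_prop)
  refine ((IsBigO.weaken h le_rfl (by norm_num : 1 ≤ 2)).add
    (IsBigO.monomial_smul h1 h2 le_rfl le_rfl)).congr_left fun p => ?_
  simp

section Steps

variable {f : Phase D → Phase D} {Φ : ℝ → Phase D → Phase D}

/-- First order expansion of a method followed by a flow. -/
theorem IsLocalFlow.expansion_step (h : IsLocalFlow f Φ) (hf : ContDiff ℝ ∞ f) {κ : ℝ → ℝ}
    (hκ : Continuous κ) {Ψ : ℝ × ℝ × Phase D → Phase D} {m : ℝ × Phase D → Phase D}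
    {x₀ : Phase D} (hm : Continuous m)
    (hΨ : (fun p => Ψ p - p.2.2 - p.2.1 • m (p.1, p.2.2))
      =O[𝓝 (0, 0, x₀)] monomial (Phase D) 0 2) :
    (fun p => Φ (κ p.1 * p.2.1) (Ψ p) - p.2.2 -
        p.2.1 • (m (p.1, p.2.2) + κ p.1 • f p.2.2))
      =O[𝓝 (0, 0, x₀)] monomial (Phase D) 0 2 := by
  have h1 := isBigO_sub_of_expansion hm hΨ
  have ht := tendsto_of_isBigO_sub h1
  have hκ1 := isBigO_monomial_time (E := Phase D) (x₀ := x₀) hκ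
  -- `Φ (κτ) Ψ = Ψ + κτ f(Ψ) + O(τ²)`, and replacing `f(Ψ)` by `f(x)` costs `κτ · O(τ)`.
  have a := (h.isBigO_taylor_one hf x₀).comp_tendsto
    ((tendsto_time (E := Phase D) hκ).prodMk_nhds ht)
  have a' : (fun p : ℝ × ℝ × Phase D => (κ p.1 * p.2.1) ^ 2)
      =O[𝓝 (0, 0, x₀)] monomial (Phase D) 0 2 :=
    (hκ1.monomial_smul hκ1 (m := 0) (n := 2) le_rfl le_rfl).congr_left fun p => by
      simp [pow_two]
  have b : (fun p => f (Ψ p) - f p.2.2) =O[𝓝 (0, 0, x₀)] monomial (Phase D) 0 1 :=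
    ((isBigO_sub_of_contDiff (hf.of_le (by exact_mod_cast le_top)) x₀).comp_tendsto
      (ht.prodMk_nhds ((continuous_snd.snd).tendsto (0, 0, x₀)))).trans h1
  have c := hκ1.monomial_smul b (m := 0) (n := 2) le_rfl le_rfl
  refine ((a.trans a').add (hΨ.add c)).congr_left fun p => ?_
  simp only [Function.comp_apply]
  module

/-- Expansion of the difference of two methods, both followed by the same flow. -/
theorem IsLocalFlow.difference_step (h : IsLocalFlow f Φ) (hf : ContDiff ℝ ∞ f) {κ : ℝ → ℝ}
    (hκ : Continuous κ) {Ψ Ψ' : ℝ × ℝ × Phase D → Phase D} {w : Phase D → Phase D}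
    {v : ℝ × Phase D → Phase D} {x₀ : Phase D} (hw : Continuous w) (hv : Continuous v)
    (hΨ : (fun p => Ψ p - p.2.2) =O[𝓝 (0, 0, x₀)] monomial (Phase D) 0 1)
    (hd : (fun p => Ψ' p - Ψ p - (p.1 ^ 3 * p.2.1 ^ 3) • (w p.2.2 + p.2.1 • v (p.1, p.2.2)))
      =O[𝓝 (0, 0, x₀)] monomial (Phase D) 3 5) :
    (fun p => Φ (κ p.1 * p.2.1) (Ψ' p) - Φ (κ p.1 * p.2.1) (Ψ p) - (p.1 ^ 3 * p.2.1 ^ 3) •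
        (w p.2.2 + p.2.1 • (v (p.1, p.2.2) + κ p.1 • fderiv ℝ f p.2.2 (w p.2.2))))
      =O[𝓝 (0, 0, x₀)] monomial (Phase D) 3 5 := by
  have hf' : Continuous (fderiv ℝ f) := hf.continuous_fderiv (by simp)
  have hκ1 := isBigO_monomial_time (E := Phase D) (x₀ := x₀) hκ
  have hb : (fun p : ℝ × ℝ × Phase D => w p.2.2 + p.2.1 • v (p.1, p.2.2))
      =O[𝓝 (0, 0, x₀)] monomial (Phase D) 0 0 :=
    isBigO_monomial_zero_of_continuous (by fun_prop)
  have hδ : (fun p => Ψ' p - Ψ p) =O[𝓝 (0, 0, x₀)] monomial (Phase D) 3 3 :=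
    ((IsBigO.weaken hd le_rfl (by norm_num : 3 ≤ 5)).add
      ((isBigO_monomial_self 3 3).monomial_smul hb le_rfl le_rfl)).congr_left fun p => by simp
  have hΨ' : (fun p => Ψ' p - p.2.2) =O[𝓝 (0, 0, x₀)] monomial (Phase D) 0 1 :=
    ((IsBigO.weaken hδ (Nat.zero_le 3) (by norm_num : 1 ≤ 3)).add hΨ).congr_left
      fun p => by simp
  have ht := tendsto_of_isBigO_sub hΨ
  have ht' := tendsto_of_isBigO_sub hΨ'
  have hx : Tendsto (fun p : ℝ × ℝ × Phase D => p.2.2) (𝓝 (0, 0, x₀)) (𝓝 x₀) :=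
    (continuous_snd.snd).tendsto (0, 0, x₀)
  -- Let `δ = Ψ' - Ψ = O(ε³τ³)`. The flow turns `δ` into `δ + κτ (f(Ψ') - f(Ψ)) + O(τ²δ)`; moreover
  -- `f(Ψ') - f(Ψ) = f'(x) δ + O(τδ)` and `δ = ε³τ³ w(x) + O(ε³τ⁴)`. Every error ends up as
  -- `O(ε³τ⁵)`.
  have a := (h.isBigO_increment hf x₀).comp_tendsto
    ((tendsto_time (E := Phase D) hκ).prodMk_nhds (ht'.prodMk_nhds ht))
  have a' : (fun p : ℝ × ℝ × Phase D => (κ p.1 * p.2.1) ^ 2 * ‖Ψ' p - Ψ p‖)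
      =O[𝓝 (0, 0, x₀)] monomial (Phase D) 3 5 :=
    (hκ1.monomial_smul (hκ1.monomial_smul hδ.norm_left (m := 3) (n := 4) le_rfl le_rfl)
      (m := 3) (n := 5) le_rfl le_rfl).congr_left fun p => by
        simp only [smul_eq_mul]
        ring
  have b := (isBigO_sub_sub_fderiv hf x₀).comp_tendsto (ht'.prodMk_nhds (ht.prodMk_nhds hx))
  have b' : (fun p : ℝ × ℝ × Phase D => (‖Ψ' p - p.2.2‖ + ‖Ψ p - p.2.2‖) * ‖Ψ' p - Ψ p‖)
      =O[𝓝 (0, 0, x₀)] monomial (Phase D) 3 4 :=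
    IsBigO.monomial_smul (hΨ'.norm_left.add hΨ.norm_left) hδ.norm_left le_rfl le_rfl
  have c := hκ1.monomial_smul (b.trans b') (m := 3) (n := 5) le_rfl le_rfl
  have e : (fun p => Ψ' p - Ψ p - (p.1 ^ 3 * p.2.1 ^ 3) • w p.2.2)
      =O[𝓝 (0, 0, x₀)] monomial (Phase D) 3 4 := by
    have hv' : (fun p : ℝ × ℝ × Phase D => v (p.1, p.2.2))
        =O[𝓝 (0, 0, x₀)] monomial (Phase D) 0 0 :=
      isBigO_monomial_zero_of_continuous (by fun_prop)
    refine ((IsBigO.weaken hd le_rfl (by norm_num : 4 ≤ 5)).add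
      ((isBigO_monomial_self 3 4).monomial_smul hv' le_rfl le_rfl)).congr_left fun p => ?_
    module
  have e' : (fun p : ℝ × ℝ × Phase D =>
      fderiv ℝ f p.2.2 (Ψ' p - Ψ p - (p.1 ^ 3 * p.2.1 ^ 3) • w p.2.2))
      =O[𝓝 (0, 0, x₀)] monomial (Phase D) 3 4 :=
    e.monomial_clm_apply hf'
  have g := hκ1.monomial_smul e' (m := 3) (n := 5) le_rfl le_rfl
  refine ((a.trans a').add (c.add (g.add hd))).congr_left fun p => ?_
  simp only [Function.comp_apply, map_sub, map_smul]
  module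

/-- Expansion of the difference of two integrators which agree up to order two, after a method. -/
theorem substitution_step {d e : Phase D → Phase D} (hd : ContDiff ℝ ∞ d) (he : ContDiff ℝ ∞ e)
    {Φ Φ' : ℝ → Phase D → Phase D} {x₀ : Phase D}
    (h : (fun p : ℝ × Phase D => Φ' p.1 p.2 - Φ p.1 p.2 - p.1 ^ 3 • d p.2 - p.1 ^ 4 • e p.2)
      =O[𝓝 (0, x₀)] fun p => p.1 ^ 5)
    (β : ℝ) {Ψ : ℝ × ℝ × Phase D → Phase D} {m : ℝ × Phase D → Phase D} (hm : Continuous m)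
    (hΨ : (fun p => Ψ p - p.2.2 - p.2.1 • m (p.1, p.2.2))
      =O[𝓝 (0, 0, x₀)] monomial (Phase D) 0 2) :
    (fun p => Φ' (p.1 * (β * p.2.1)) (Ψ p) - Φ (p.1 * (β * p.2.1)) (Ψ p) -
        (p.1 ^ 3 * p.2.1 ^ 3) • (β ^ 3 • d p.2.2 + p.2.1 •
          (β ^ 3 • fderiv ℝ d p.2.2 (m (p.1, p.2.2)) + (β ^ 4 * p.1) • e p.2.2)))
      =O[𝓝 (0, 0, x₀)] monomial (Phase D) 3 5 := by
  have hd' : Continuous (fderiv ℝ d) := hd.continuous_fderiv (by simp)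
  have h1 := isBigO_sub_of_expansion hm hΨ
  have ht := tendsto_of_isBigO_sub h1
  have hx : Tendsto (fun p : ℝ × ℝ × Phase D => p.2.2) (𝓝 (0, 0, x₀)) (𝓝 x₀) :=
    (continuous_snd.snd).tendsto (0, 0, x₀)
  have hh : Tendsto (fun p : ℝ × ℝ × Phase D => p.1 * (β * p.2.1)) (𝓝 (0, 0, x₀)) (𝓝 0) := by
    have : Continuous fun p : ℝ × ℝ × Phase D => p.1 * (β * p.2.1) := by fun_prop
    simpa using this.tendsto (0, 0, x₀)
  have hpow : ∀ n : ℕ, (fun p : ℝ × ℝ × Phase D => (p.1 * (β * p.2.1)) ^ n)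
      =O[𝓝 (0, 0, x₀)] monomial (Phase D) n n := fun n =>
    ((isBigO_monomial_self n n).const_mul_left (β ^ n)).congr_left fun p => by
      simp only [mul_pow]
      ring
  -- The substep is `h = εβτ`. In the `h³` term the base point must be expanded as `d(Ψ) = d(x) + τ
  -- d'(x) m + O(τ²)`; in the `h⁴` term `e(Ψ) = e(x) + O(τ)` suffices.
  have a := (h.comp_tendsto (hh.prodMk_nhds ht)).trans (hpow 5)
  have b := (isBigO_sub_sub_fderiv hd x₀).comp_tendsto (ht.prodMk_nhds (hx.prodMk_nhds hx))
  have b' : (fun p : ℝ × ℝ × Phase D =>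
      (‖Ψ p - p.2.2‖ + ‖p.2.2 - p.2.2‖) * ‖Ψ p - p.2.2‖)
      =O[𝓝 (0, 0, x₀)] monomial (Phase D) 0 2 :=
    (IsBigO.monomial_smul h1.norm_left h1.norm_left (m := 0) (n := 2) le_rfl
      le_rfl).congr_left fun p => by simp
  have c : (fun p : ℝ × ℝ × Phase D =>
      fderiv ℝ d p.2.2 (Ψ p - p.2.2 - p.2.1 • m (p.1, p.2.2)))
      =O[𝓝 (0, 0, x₀)] monomial (Phase D) 0 2 :=
    hΨ.monomial_clm_apply hd'
  have bc := (hpow 3).monomial_smul ((b.trans b').add c) (m := 3) (n := 5) le_rfl le_rfl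
  have e1 : (fun p => e (Ψ p) - e p.2.2) =O[𝓝 (0, 0, x₀)] monomial (Phase D) 0 1 :=
    ((isBigO_sub_of_contDiff (he.of_le (by exact_mod_cast le_top)) x₀).comp_tendsto
      (ht.prodMk_nhds hx)).trans h1
  have e2 := (hpow 4).monomial_smul e1 (m := 3) (n := 5) (by norm_num) le_rfl
  refine (IsBigO.add (IsBigO.weaken a (by norm_num : 3 ≤ 5) le_rfl)
    (bc.add e2)).congr_left fun p => ?_
  simp only [Function.comp_apply, map_sub, map_smul]
  module

end Steps

end SplittingFlow

/-! ### Composition methods: reversal, and substitution of the integrator for the flow. -/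

namespace SplittingFlow

variable {D : ℕ}

section Reversal

variable {Φa Φb : ℝ → Phase D → Phase D}

theorem splitting_succ_apply (s : ℕ) (a : Fin (s + 2) → ℝ) (b : Fin (s + 1) → ℝ) (ε τ : ℝ)
    (x : Phase D) :
    splitting Φa Φb (s + 1) a b ε τ x = Φa (a (Fin.last (s + 1)) * τ)
      (Φb (ε * (b (Fin.last s) * τ))
        (splitting Φa Φb s (fun i => a i.castSucc) (fun i => b i.castSucc) ε τ x)) := rfl

/-- A composition method, with its first two factors split off. -/
theorem splitting_succ_eq_tail (s : ℕ) (a : Fin (s + 2) → ℝ) (b : Fin (s + 1) → ℝ) (ε τ : ℝ)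
    (x : Phase D) :
    splitting Φa Φb (s + 1) a b ε τ x =
      splitting Φa Φb s (fun i => a i.succ) (fun i => b i.succ) ε τ
        (Φb (ε * (b 0 * τ)) (Φa (a 0 * τ) x)) := by
  induction s with
  | zero => rfl
  | succ s ih =>
    rw [splitting_succ_apply, ih, splitting_succ_apply]
    rfl

/-- Keeps every intermediate point of the composition near `x₀`, where the local hypotheses on `Φa`
and `Φb` apply. -/
theorem tendsto_splitting
    (ha : ∀ x₀, Tendsto (fun p : ℝ × Phase D => Φa p.1 p.2) (𝓝 (0, x₀)) (𝓝 x₀))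
    (hb : ∀ x₀, Tendsto (fun p : ℝ × Phase D => Φb p.1 p.2) (𝓝 (0, x₀)) (𝓝 x₀))
    (s : ℕ) (a : Fin (s + 1) → ℝ) (b : Fin s → ℝ) (x₀ : Phase D) :
    Tendsto (fun p : ℝ × ℝ × Phase D => splitting Φa Φb s a b p.1 p.2.1 p.2.2)
      (𝓝 (0, 0, x₀)) (𝓝 x₀) := by
  induction s with
  | zero =>
    exact (ha x₀).comp ((tendsto_time (κ := fun _ => a 0) continuous_const).prodMk_nhds
      ((continuous_snd.snd).tendsto (0, 0, x₀)))
  | succ s ih =>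
    have h1 := (hb x₀).comp ((tendsto_time (E := Phase D) (κ := fun ε => ε * b (Fin.last s))
      (by fun_prop)).prodMk_nhds (ih (fun i => a i.castSucc) (fun i => b i.castSucc)))
    have h2 := (ha x₀).comp ((tendsto_time (E := Phase D)
      (κ := fun _ => a (Fin.last (s + 1))) continuous_const).prodMk_nhds h1)
    refine h2.congr fun p => ?_
    simp only [Function.comp_apply, mul_assoc, splitting_succ_apply]

/-- The composition with reversed coefficients and negated step inverts a composition of
self-adjoint maps. -/
theorem splitting_rev_splitting
    (ha : ∀ x₀, Tendsto (fun p : ℝ × Phase D => Φa p.1 p.2) (𝓝 (0, x₀)) (𝓝 x₀))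
    (hb : ∀ x₀, Tendsto (fun p : ℝ × Phase D => Φb p.1 p.2) (𝓝 (0, x₀)) (𝓝 x₀))
    (sa : ∀ x₀, ∀ᶠ p in 𝓝 ((0 : ℝ), x₀), Φa (-p.1) (Φa p.1 p.2) = p.2)
    (sb : ∀ x₀, ∀ᶠ p in 𝓝 ((0 : ℝ), x₀), Φb (-p.1) (Φb p.1 p.2) = p.2)
    (s : ℕ) (a : Fin (s + 1) → ℝ) (b : Fin s → ℝ) (x₀ : Phase D) :
    ∀ᶠ p : ℝ × ℝ × Phase D in 𝓝 (0, 0, x₀),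
      splitting Φa Φb s (fun i => a i.rev) (fun i => b i.rev) p.1 (-p.2.1)
        (splitting Φa Φb s a b p.1 p.2.1 p.2.2) = p.2.2 := by
  induction s with
  | zero =>
    filter_upwards [((tendsto_time (κ := fun _ => a 0) continuous_const).prodMk_nhds
      ((continuous_snd.snd).tendsto ((0 : ℝ), (0 : ℝ), x₀))).eventually (sa x₀)] with p hp
    simp only [splitting, mul_neg]
    exact hp
  | succ s ih =>
    have t0 := tendsto_splitting ha hb s (fun i => a i.castSucc) (fun i => b i.castSucc) x₀
    have t1 := (tendsto_time (E := Phase D) (κ := fun ε => ε * b (Fin.last s))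
      (by fun_prop)).prodMk_nhds t0
    have t2 := (tendsto_time (E := Phase D) (κ := fun _ => a (Fin.last (s + 1)))
      continuous_const).prodMk_nhds ((hb x₀).comp t1)
    filter_upwards [ih (fun i => a i.castSucc) (fun i => b i.castSucc), t1.eventually (sb x₀),
      t2.eventually (sa x₀)] with p h0 h1 h2
    -- The last two factors of the method meet the first two of its reversal and cancel: `h2` for
    -- `Φa`, then `h1` for `Φb`.
    rw [splitting_succ_eq_tail, splitting_succ_apply]
    simp only [Fin.rev_zero, mul_neg, Fin.rev_succ, Function.comp_apply, mul_assoc] at h0 h1 h2 ⊢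
    rw [h2, h1, h0]

theorem IsPalindromic.splitting_splitting {s : ℕ} {a : Fin (s + 1) → ℝ} {b : Fin s → ℝ}
    (h : IsPalindromic a b)
    (ha : ∀ x₀, Tendsto (fun p : ℝ × Phase D => Φa p.1 p.2) (𝓝 (0, x₀)) (𝓝 x₀))
    (hb : ∀ x₀, Tendsto (fun p : ℝ × Phase D => Φb p.1 p.2) (𝓝 (0, x₀)) (𝓝 x₀))
    (sa : ∀ x₀, ∀ᶠ p in 𝓝 ((0 : ℝ), x₀), Φa (-p.1) (Φa p.1 p.2) = p.2)
    (sb : ∀ x₀, ∀ᶠ p in 𝓝 ((0 : ℝ), x₀), Φb (-p.1) (Φb p.1 p.2) = p.2) (x₀ : Phase D) :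
    ∀ᶠ p : ℝ × ℝ × Phase D in 𝓝 (0, 0, x₀),
      splitting Φa Φb s a b p.1 (-p.2.1) (splitting Φa Φb s a b p.1 p.2.1 p.2.2) = p.2.2 := by
  have := splitting_rev_splitting ha hb sa sb s a b x₀
  simpa only [h.1, h.2] using this

end Reversal

section Substitution

variable {fa fb d e : Phase D → Phase D} {φa φb χ : ℝ → Phase D → Phase D}

/-- First order expansion of a splitting method, and expansion of the effect of replacing one of
the flows by an integrator of order two. -/
theorem splitting_expansion (hfa : ContDiff ℝ ∞ fa) (hfb : ContDiff ℝ ∞ fb)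
    (hd : ContDiff ℝ ∞ d) (he : ContDiff ℝ ∞ e)
    (hφa : IsLocalFlow fa φa) (hφb : IsLocalFlow fb φb)
    (hχ : ∀ x₀, (fun p : ℝ × Phase D => χ p.1 p.2 - φb p.1 p.2 - p.1 ^ 3 • d p.2 -
      p.1 ^ 4 • e p.2) =O[𝓝 (0, x₀)] fun p => p.1 ^ 5)
    (s : ℕ) (a : Fin (s + 1) → ℝ) (b : Fin s → ℝ) :
    ∃ m v : ℝ × Phase D → Phase D, ContDiff ℝ ∞ m ∧ ContDiff ℝ ∞ v ∧ ∀ x₀,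
      (fun p : ℝ × ℝ × Phase D => splitting φa φb s a b p.1 p.2.1 p.2.2 - p.2.2 -
        p.2.1 • m (p.1, p.2.2)) =O[𝓝 (0, 0, x₀)] monomial (Phase D) 0 2 ∧
      (fun p : ℝ × ℝ × Phase D => splitting φa χ s a b p.1 p.2.1 p.2.2 -
        splitting φa φb s a b p.1 p.2.1 p.2.2 -
        (p.1 ^ 3 * p.2.1 ^ 3) • ((∑ j, b j ^ 3) • d p.2.2 + p.2.1 • v (p.1, p.2.2)))
        =O[𝓝 (0, 0, x₀)] monomial (Phase D) 3 5 := by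
  induction s with
  | zero =>
    refine ⟨fun q => a 0 • fa q.2, fun _ => 0, by fun_prop, contDiff_const, fun x₀ => ⟨?_, ?_⟩⟩
    · have := hφa.expansion_step hfa (κ := fun _ => a 0) continuous_const
        (Ψ := fun p => p.2.2) (m := fun _ => 0) (x₀ := x₀) continuous_const
        ((isBigO_zero _ _).congr_left fun p => by simp)
      refine this.congr_left fun p => ?_
      simp [splitting]
    · refine (isBigO_zero _ _).congr_left fun p => ?_
      simp [splitting]
  | succ s ih =>
    obtain ⟨m, v, hm, hv, H⟩ := ih (fun i => a i.castSucc) (fun i => b i.castSucc)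
    set β := b (Fin.last s) with hβ
    set α := a (Fin.last (s + 1)) with hα
    set c := ∑ j : Fin s, b j.castSucc ^ 3 with hc
    have hsum : ∑ j, b j ^ 3 = c + β ^ 3 := Fin.sum_univ_castSucc _
    have hfb' : ContDiff ℝ ∞ (fderiv ℝ fb) := hfb.fderiv_right (by norm_num)
    have hfa' : ContDiff ℝ ∞ (fderiv ℝ fa) := hfa.fderiv_right (by norm_num)
    have hd' : ContDiff ℝ ∞ (fderiv ℝ d) := hd.fderiv_right (by norm_num)
    -- Index `1` is after the new `b`-step, index `2` after the new `a`-step. In `v₁`, the first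
    -- summand transports the previous difference through `φb`, the second is created by replacing
    -- `φb` with `χ`.
    let m₁ : ℝ × Phase D → Phase D := fun q => m q + (q.1 * β) • fb q.2
    let v₁ : ℝ × Phase D → Phase D := fun q =>
      (v q + (q.1 * β) • fderiv ℝ fb q.2 (c • d q.2)) +
      (β ^ 3 • fderiv ℝ d q.2 (m q) + (β ^ 4 * q.1) • e q.2)
    let m₂ : ℝ × Phase D → Phase D := fun q => m₁ q + α • fa q.2
    let v₂ : ℝ × Phase D → Phase D := fun q =>
      v₁ q + α • fderiv ℝ fa q.2 ((c + β ^ 3) • d q.2)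
    have hm₁ : ContDiff ℝ ∞ m₁ := by fun_prop
    have hv₁ : ContDiff ℝ ∞ v₁ := by fun_prop
    have hm₂ : ContDiff ℝ ∞ m₂ := by fun_prop
    have hv₂ : ContDiff ℝ ∞ v₂ := by fun_prop
    refine ⟨m₂, v₂, hm₂, hv₂, fun x₀ => ?_⟩
    obtain ⟨H1, H2⟩ := H x₀
    -- The new `χ` acts on the already modified scheme, which has the same first order field since
    -- the two schemes differ by `O(ε³τ³)`.
    have H1' : (fun p : ℝ × ℝ × Phase D => splitting φa χ s (fun i => a i.castSucc)
        (fun i => b i.castSucc) p.1 p.2.1 p.2.2 - p.2.2 - p.2.1 • m (p.1, p.2.2))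
        =O[𝓝 (0, 0, x₀)] monomial (Phase D) 0 2 := by
      have hb : (fun p : ℝ × ℝ × Phase D => c • d p.2.2 + p.2.1 • v (p.1, p.2.2))
          =O[𝓝 (0, 0, x₀)] monomial (Phase D) 0 0 :=
        isBigO_monomial_zero_of_continuous (by fun_prop)
      refine ((H2.weaken (Nat.zero_le 3) (by norm_num : 2 ≤ 5)).add
        (((isBigO_monomial_self 3 3).monomial_smul hb (m := 0) (n := 2) (by norm_num)
          (by norm_num)).add H1)).congr_left fun p => ?_
      module
    -- `χ(Ψ') - φb(Ψ) = (φb(Ψ') - φb(Ψ)) + (χ(Ψ') - φb(Ψ'))`; the summands are treated in `K2` and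
    -- `K3`.
    have K1 := hφb.expansion_step hfb (κ := fun ε => ε * β) (by fun_prop) hm.continuous H1
    have K2 := hφb.difference_step hfb (κ := fun ε => ε * β) (by fun_prop)
      (w := fun x => c • d x) (by fun_prop) hv.continuous
      (isBigO_sub_of_expansion hm.continuous H1) H2
    have K3 := substitution_step hd he (hχ x₀) β hm.continuous H1'
    simp only [mul_assoc] at K1 K2
    have K1' : (fun p : ℝ × ℝ × Phase D => φb (p.1 * (β * p.2.1)) (splitting φa φb s
        (fun i => a i.castSucc) (fun i => b i.castSucc) p.1 p.2.1 p.2.2) - p.2.2 -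
        p.2.1 • m₁ (p.1, p.2.2)) =O[𝓝 (0, 0, x₀)] monomial (Phase D) 0 2 := K1
    have K4 : (fun p : ℝ × ℝ × Phase D => χ (p.1 * (β * p.2.1)) (splitting φa χ s
        (fun i => a i.castSucc) (fun i => b i.castSucc) p.1 p.2.1 p.2.2) -
        φb (p.1 * (β * p.2.1)) (splitting φa φb s
        (fun i => a i.castSucc) (fun i => b i.castSucc) p.1 p.2.1 p.2.2) -
        (p.1 ^ 3 * p.2.1 ^ 3) • ((c + β ^ 3) • d p.2.2 + p.2.1 • v₁ (p.1, p.2.2)))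
        =O[𝓝 (0, 0, x₀)] monomial (Phase D) 3 5 := by
      refine (K2.add K3).congr_left fun p => ?_
      simp only [v₁]
      module
    have L1 := hφa.expansion_step hfa (κ := fun _ => α) continuous_const hm₁.continuous K1'
    have L2 := hφa.difference_step hfa (κ := fun _ => α) continuous_const
      (w := fun x => (c + β ^ 3) • d x) (by fun_prop) hv₁.continuous
      (isBigO_sub_of_expansion hm₁.continuous K1') K4
    rw [hsum]
    exact ⟨L1, L2⟩

/-- A splitting method of small step moves two nearby points in the same way, up to higher order
terms. -/
theorem splitting_difference (hfa : ContDiff ℝ ∞ fa) (hfb : ContDiff ℝ ∞ fb)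
    (hφa : IsLocalFlow fa φa) (hφb : IsLocalFlow fb φb) {x₀ : Phase D}
    {Ψ Ψ' : ℝ × ℝ × Phase D → Phase D} {m v : ℝ × Phase D → Phase D} (hm : Continuous m)
    (hv : Continuous v)
    (hΨ : (fun p => Ψ p - p.2.2 - p.2.1 • m (p.1, p.2.2))
      =O[𝓝 (0, 0, x₀)] monomial (Phase D) 0 2)
    (hΨ' : (fun p => Ψ' p - Ψ p - (p.1 ^ 3 * p.2.1 ^ 4) • v (p.1, p.2.2))
      =O[𝓝 (0, 0, x₀)] monomial (Phase D) 3 5)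
    (s : ℕ) (a : Fin (s + 1) → ℝ) (b : Fin s → ℝ) :
    (∃ m' : ℝ × Phase D → Phase D, Continuous m' ∧
      (fun p => splitting φa φb s a b p.1 (-p.2.1) (Ψ p) - p.2.2 - p.2.1 • m' (p.1, p.2.2))
        =O[𝓝 (0, 0, x₀)] monomial (Phase D) 0 2) ∧
    (fun p => splitting φa φb s a b p.1 (-p.2.1) (Ψ' p) -
        splitting φa φb s a b p.1 (-p.2.1) (Ψ p) - (p.1 ^ 3 * p.2.1 ^ 4) • v (p.1, p.2.2))
      =O[𝓝 (0, 0, x₀)] monomial (Phase D) 3 5 := by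
  -- The case `w = 0` of `difference_step`: a leading difference of order `ε³τ⁴` changes only by
  -- `O(ε³τ⁵)`.
  have step : ∀ {f : Phase D → Phase D} {Φ : ℝ → Phase D → Phase D} (_ : ContDiff ℝ ∞ f)
      (_ : IsLocalFlow f Φ) {κ : ℝ → ℝ} (_ : Continuous κ)
      {Ψ Ψ' : ℝ × ℝ × Phase D → Phase D} {m : ℝ × Phase D → Phase D} (_ : Continuous m)
      (_ : (fun p => Ψ p - p.2.2 - p.2.1 • m (p.1, p.2.2))
        =O[𝓝 (0, 0, x₀)] monomial (Phase D) 0 2)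
      (_ : (fun p => Ψ' p - Ψ p - (p.1 ^ 3 * p.2.1 ^ 4) • v (p.1, p.2.2))
        =O[𝓝 (0, 0, x₀)] monomial (Phase D) 3 5),
      (fun p => Φ (κ p.1 * p.2.1) (Ψ' p) - Φ (κ p.1 * p.2.1) (Ψ p) -
        (p.1 ^ 3 * p.2.1 ^ 4) • v (p.1, p.2.2))
        =O[𝓝 (0, 0, x₀)] monomial (Phase D) 3 5 := by
    intro f Φ hf h κ hκ Ψ Ψ' m hm hΨ hΨ'
    have := h.difference_step hf hκ (w := fun _ => 0) (v := v) continuous_const hv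
      (isBigO_sub_of_expansion hm hΨ) (hΨ'.congr_left fun p => by module)
    refine this.congr_left fun p => ?_
    simp only [map_zero]
    module
  induction s with
  | zero =>
    have h1 := hφa.expansion_step hfa (κ := fun _ => -a 0) continuous_const hm hΨ
    have h2 := step hfa hφa (κ := fun _ => -a 0) continuous_const hm hΨ hΨ'
    simp only [neg_mul] at h1 h2
    simp only [splitting, mul_neg]
    exact ⟨⟨fun q => m q + (-a 0) • fa q.2, by fun_prop, by simpa only [neg_smul] using h1⟩, h2⟩
  | succ s ih =>
    obtain ⟨⟨m₀, hm₀, H1⟩, H2⟩ := ih (fun i => a i.castSucc) (fun i => b i.castSucc)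
    set β := b (Fin.last s) with hβ
    set α := a (Fin.last (s + 1)) with hα
    have K1 := hφb.expansion_step hfb (κ := fun ε => -(ε * β)) (by fun_prop) hm₀ H1
    have K2 := step hfb hφb (κ := fun ε => -(ε * β)) (by fun_prop) hm₀ H1 H2
    have hm₁ : Continuous fun q : ℝ × Phase D => m₀ q + (-(q.1 * β)) • fb q.2 := by fun_prop
    have L1 := hφa.expansion_step hfa (κ := fun _ => -α) continuous_const hm₁ K1
    have L2 := step hfa hφa (κ := fun _ => -α) continuous_const hm₁ K1 K2
    simp only [neg_mul, mul_assoc] at L1 L2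
    simp only [splitting_succ_apply, mul_neg, ← hα, ← hβ]
    exact ⟨⟨fun q => (m₀ q + (-(q.1 * β)) • fb q.2) + (-α) • fa q.2, by fun_prop, by
      simpa only [mul_assoc] using L1⟩, L2⟩

/-- The even term of order four in the difference of two symmetric methods vanishes. -/
theorem splitting_sub_splitting_isBigO_of_palindromic (hfa : ContDiff ℝ ∞ fa)
    (hfb : ContDiff ℝ ∞ fb) (hd : ContDiff ℝ ∞ d) (he : ContDiff ℝ ∞ e)
    (hφa : IsLocalFlow fa φa) (hφb : IsLocalFlow fb φb)
    (hχ : ∀ x₀, (fun p : ℝ × Phase D => χ p.1 p.2 - φb p.1 p.2 - p.1 ^ 3 • d p.2 -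
      p.1 ^ 4 • e p.2) =O[𝓝 (0, x₀)] fun p => p.1 ^ 5)
    (hχt : ∀ x₀, Tendsto (fun p : ℝ × Phase D => χ p.1 p.2) (𝓝 (0, x₀)) (𝓝 x₀))
    (hχs : ∀ x₀, ∀ᶠ p in 𝓝 ((0 : ℝ), x₀), χ (-p.1) (χ p.1 p.2) = p.2)
    {s : ℕ} {a : Fin (s + 1) → ℝ} {b : Fin s → ℝ} (hab : IsPalindromic a b)
    (hb : ∑ j, b j ^ 3 = 0) (x₀ : Phase D) :
    (fun p : ℝ × ℝ × Phase D => splitting φa χ s a b p.1 p.2.1 p.2.2 -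
      splitting φa φb s a b p.1 p.2.1 p.2.2) =O[𝓝 (0, 0, x₀)] monomial (Phase D) 3 5 := by
  have h1 : ∀ {f : Phase D → Phase D}, ContDiff ℝ ∞ f → ContDiff ℝ 1 f :=
    fun h => h.of_le (by exact_mod_cast le_top)
  have ta := fun x₀ => hφa.tendsto hfa.continuous x₀
  have tb := fun x₀ => hφb.tendsto hfb.continuous x₀
  have sa := fun x₀ => hφa.symm (h1 hfa) x₀
  have sb := fun x₀ => hφb.symm (h1 hfb) x₀
  obtain ⟨m, v, hm, hv, H⟩ := splitting_expansion hfa hfb hd he hφa hφb hχ s a b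
  have H' : ∀ x₀, (fun p : ℝ × ℝ × Phase D => splitting φa χ s a b p.1 p.2.1 p.2.2 -
      splitting φa φb s a b p.1 p.2.1 p.2.2 - (p.1 ^ 3 * p.2.1 ^ 4) • v (p.1, p.2.2))
      =O[𝓝 (0, 0, x₀)] monomial (Phase D) 3 5 := fun x₀ => by
    refine (H x₀).2.congr_left fun p => ?_
    rw [hb]
    module
  -- `ψ_{-τ}(ψ̃_τ x) - ψ_{-τ}(ψ_τ x) = ε³τ⁴ v(x) + O(ε³τ⁵)`.
  have hΔ := (splitting_difference hfa hfb hφa hφb hm.continuous hv.continuous (H x₀).1 (H' x₀)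
    s a b).2
  have hχt' := tendsto_splitting ta hχt s a b x₀
  have hrev : Tendsto (fun p : ℝ × ℝ × Phase D =>
      (p.1, -p.2.1, splitting φa χ s a b p.1 p.2.1 p.2.2)) (𝓝 (0, 0, x₀)) (𝓝 (0, 0, x₀)) := by
    refine (continuous_fst.tendsto _).prodMk_nhds (Tendsto.prodMk_nhds ?_ hχt')
    have : Continuous fun p : ℝ × ℝ × Phase D => -p.2.1 := by fun_prop
    simpa using this.tendsto (0, 0, x₀)
  -- The expansion of `ψ̃ - ψ` at step `-τ` and base point `ψ̃_τ x`; since `(-τ)⁴ = τ⁴`, the leading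
  -- term keeps its sign.
  have hback := (H' x₀).comp_tendsto hrev
  have hback' : (monomial (Phase D) 3 5 ∘ fun p : ℝ × ℝ × Phase D =>
      (p.1, -p.2.1, splitting φa χ s a b p.1 p.2.1 p.2.2))
      =O[𝓝 (0, 0, x₀)] monomial (Phase D) 3 5 :=
    (isBigO_refl _ _).neg_left.congr_left fun p => by
      simp only [monomial, Function.comp_apply]
      ring
  have hvdiff : (fun p : ℝ × ℝ × Phase D =>
      v (p.1, splitting φa χ s a b p.1 p.2.1 p.2.2) - v (p.1, p.2.2))
      =O[𝓝 (0, 0, x₀)] monomial (Phase D) 0 1 := by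
    have t1 : Tendsto (fun p : ℝ × ℝ × Phase D =>
        ((p.1, splitting φa χ s a b p.1 p.2.1 p.2.2), (p.1, p.2.2))) (𝓝 (0, 0, x₀))
        (𝓝 ((0, x₀), (0, x₀))) :=
      ((continuous_fst.tendsto (0, 0, x₀)).prodMk_nhds hχt').prodMk_nhds
        ((continuous_fst.tendsto (0, 0, x₀)).prodMk_nhds
          ((continuous_snd.snd).tendsto (0, 0, x₀)))
    have t2 := (isBigO_sub_of_contDiff (hv.of_le (by exact_mod_cast le_top))
      ((0 : ℝ), x₀)).comp_tendsto t1
    refine t2.trans ?_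
    have t3 : (fun p : ℝ × ℝ × Phase D => splitting φa χ s a b p.1 p.2.1 p.2.2 - p.2.2)
        =O[𝓝 (0, 0, x₀)] monomial (Phase D) 0 1 := by
      have hv0 : (fun p : ℝ × ℝ × Phase D => v (p.1, p.2.2))
          =O[𝓝 (0, 0, x₀)] monomial (Phase D) 0 0 :=
        isBigO_monomial_zero_of_continuous (by fun_prop)
      refine (((H' x₀).weaken (Nat.zero_le 3) (by norm_num : 1 ≤ 5)).add
        (((isBigO_monomial_self 3 4).monomial_smul hv0 (m := 0) (n := 1) (by norm_num)
          (by norm_num)).add (isBigO_sub_of_expansion hm.continuous (H x₀).1))).congr_left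
          fun p => ?_
      module
    refine IsBigO.trans (IsBigO.of_bound 1 (Eventually.of_forall fun p => ?_)) t3
    simp [Prod.norm_def]
  have hvdiff' := (isBigO_monomial_self 3 4).monomial_smul hvdiff (m := 3) (n := 5) le_rfl le_rfl
  have hlead : (fun p : ℝ × ℝ × Phase D => (p.1 ^ 3 * p.2.1 ^ 4) • v (p.1, p.2.2))
      =O[𝓝 (0, 0, x₀)] monomial (Phase D) 3 5 := by
    -- By symmetry of both methods, the differences in `hΔ` and `hback` are `ψ_{-τ}(ψ̃_τ x) - x` and
    -- `x - ψ_{-τ}(ψ̃_τ x)`. They cancel, leaving `-2 ε³τ⁴ v(x)`.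
    refine (((hΔ.add (hback.trans hback')).add hvdiff').const_smul_left
      (-(1 / 2) : ℝ)).congr' ?_ EventuallyEq.rfl
    filter_upwards [hab.splitting_splitting ta tb sa sb x₀,
      hab.splitting_splitting ta hχt sa hχs x₀] with p e1 e2
    simp only [Function.comp_apply, Pi.smul_apply, e1, e2]
    module
  refine ((H' x₀).add hlead).congr_left fun p => ?_
  module

/-- The leading term of the difference of the two schemes, in an observable. -/
theorem splitting_observable_difference (hfa : ContDiff ℝ ∞ fa)
    (hfb : ContDiff ℝ ∞ fb) (hd : ContDiff ℝ ∞ d) (he : ContDiff ℝ ∞ e)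
    (hφa : IsLocalFlow fa φa) (hφb : IsLocalFlow fb φb)
    (hχ : ∀ x₀, (fun p : ℝ × Phase D => χ p.1 p.2 - φb p.1 p.2 - p.1 ^ 3 • d p.2 -
      p.1 ^ 4 • e p.2) =O[𝓝 (0, x₀)] fun p => p.1 ^ 5)
    (s : ℕ) (a : Fin (s + 1) → ℝ) (b : Fin s → ℝ) {F : Type*} [NormedAddCommGroup F]
    [NormedSpace ℝ F] {g : Phase D → F} (hg : ContDiff ℝ ∞ g) (x₀ : Phase D) :
    (fun p : ℝ × ℝ × Phase D => g (splitting φa χ s a b p.1 p.2.1 p.2.2) -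
        g (splitting φa φb s a b p.1 p.2.1 p.2.2) -
        ((∑ j, b j ^ 3) * p.1 ^ 3 * p.2.1 ^ 3) • fderiv ℝ g p.2.2 (d p.2.2))
      =O[𝓝 (0, 0, x₀)] monomial (Phase D) 3 4 := by
  obtain ⟨m, v, hm, hv, H⟩ := splitting_expansion hfa hfb hd he hφa hφb hχ s a b
  obtain ⟨H1, H2⟩ := H x₀
  have h0 := isBigO_sub_of_expansion hm.continuous H1
  have hv0 : (fun p : ℝ × ℝ × Phase D => v (p.1, p.2.2))
      =O[𝓝 (0, 0, x₀)] monomial (Phase D) 0 0 :=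
    isBigO_monomial_zero_of_continuous (by fun_prop)
  have hd0 : (fun p : ℝ × ℝ × Phase D => (∑ j, b j ^ 3) • d p.2.2)
      =O[𝓝 (0, 0, x₀)] monomial (Phase D) 0 0 :=
    isBigO_monomial_zero_of_continuous (by fun_prop)
  have hΔ1 : (fun p : ℝ × ℝ × Phase D => splitting φa χ s a b p.1 p.2.1 p.2.2 -
      splitting φa φb s a b p.1 p.2.1 p.2.2 -
      (p.1 ^ 3 * p.2.1 ^ 3) • ((∑ j, b j ^ 3) • d p.2.2))
      =O[𝓝 (0, 0, x₀)] monomial (Phase D) 3 4 := by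
    refine ((H2.weaken le_rfl (by norm_num : 4 ≤ 5)).add ((isBigO_monomial_self 3 4).monomial_smul
      hv0 le_rfl le_rfl)).congr_left fun p => ?_
    module
  have hΔ : (fun p : ℝ × ℝ × Phase D => splitting φa χ s a b p.1 p.2.1 p.2.2 -
      splitting φa φb s a b p.1 p.2.1 p.2.2) =O[𝓝 (0, 0, x₀)] monomial (Phase D) 3 3 :=
    ((hΔ1.weaken le_rfl (by norm_num : 3 ≤ 4)).add ((isBigO_monomial_self 3 3).monomial_smul
      hd0 le_rfl le_rfl)).congr_left fun p => by module
  have h0' : (fun p : ℝ × ℝ × Phase D => splitting φa χ s a b p.1 p.2.1 p.2.2 - p.2.2)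
      =O[𝓝 (0, 0, x₀)] monomial (Phase D) 0 1 :=
    ((hΔ.weaken (Nat.zero_le 3) (by norm_num : 1 ≤ 3)).add h0).congr_left fun p => by module
  -- Linearizing `g` at `x` costs `(‖ψ̃ - x‖ + ‖ψ - x‖) ‖ψ̃ - ψ‖ = O(τ · ε³τ³)`.
  have k1 := (isBigO_sub_sub_fderiv hg x₀).comp_tendsto ((tendsto_of_isBigO_sub h0').prodMk_nhds
    ((tendsto_of_isBigO_sub h0).prodMk_nhds ((continuous_snd.snd).tendsto (0, 0, x₀))))
  have k2 := IsBigO.monomial_smul (h0'.norm_left.add h0.norm_left) hΔ.norm_left (m := 3) (n := 4)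
    le_rfl le_rfl
  have k3 := hΔ1.monomial_clm_apply (hg.continuous_fderiv (by simp))
  refine ((k1.trans k2).add k3).congr_left fun p => ?_
  simp only [Function.comp_apply, map_sub, map_smul]
  module

end Substitution

end SplittingFlow

/-! ### Formal exponentials over noncommutative algebras. -/

namespace SplittingFlow

section FormalExp

variable {R T : Type*} [Ring R] [Ring T]

open PowerSeries in
theorem coeff_pow_eq_zero_of_lt {F : PowerSeries R} (hF : coeff 0 F = 0) (m : ℕ) :
    ∀ k < m, coeff k (F ^ m) = 0 := by
  induction m with
  | zero => simp
  | succ m ih =>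
    intro k hk
    rw [pow_succ, coeff_mul]
    refine Finset.sum_eq_zero fun ij hij => ?_
    rw [Finset.HasAntidiagonal.mem_antidiagonal] at hij
    rcases lt_or_ge ij.1 m with h | h
    · rw [ih _ h, zero_mul]
    · rw [show ij.2 = 0 by omega, hF, mul_zero]

open PowerSeries in
theorem coeff_pow_congr {F G : PowerSeries R} {n : ℕ}
    (h : ∀ k < n, coeff k F = coeff k G) (m : ℕ) :
    ∀ k < n, coeff k (F ^ m) = coeff k (G ^ m) := by
  induction m with
  | zero => simp
  | succ m ih =>
    intro k hk
    rw [pow_succ, pow_succ, coeff_mul, coeff_mul]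
    refine Finset.sum_congr rfl fun ij hij => ?_
    rw [Finset.HasAntidiagonal.mem_antidiagonal] at hij
    rw [ih _ (by omega), h _ (by omega)]

variable [Algebra ℝ R] [Algebra ℝ T]

open PowerSeries in
-- A summation bound independent of `k` is what allows exponentials to be multiplied
-- coefficientwise.
theorem coeff_formalExp {F : PowerSeries R} (hF : coeff 0 F = 0) {k M : ℕ} (hM : k < M) :
    coeff k (formalExp F) =
      ∑ m ∈ Finset.range M, ((m.factorial : ℝ)⁻¹) • coeff k (F ^ m) := by
  rw [formalExp, coeff_mk]
  refine Finset.sum_subset (Finset.range_mono hM) fun m _ hm => ?_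
  rw [Finset.mem_range, not_lt] at hm
  rw [coeff_pow_eq_zero_of_lt hF m k hm, smul_zero]

theorem formalExp_map (φ : R →ₐ[ℝ] T) (F : PowerSeries R) :
    formalExp (PowerSeries.map φ.toRingHom F) = PowerSeries.map φ.toRingHom (formalExp F) := by
  ext k
  rw [formalExp, formalExp, PowerSeries.coeff_mk, PowerSeries.coeff_map, PowerSeries.coeff_mk,
    map_sum]
  refine Finset.sum_congr rfl fun m _ => ?_
  rw [← map_pow, PowerSeries.coeff_map]
  exact (map_smul φ _ _).symm

theorem formalExp_zero : formalExp (0 : PowerSeries R) = 1 := by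
  ext k
  rw [formalExp, PowerSeries.coeff_mk, Finset.sum_eq_single 0]
  · simp
  · intro m _ hm
    rw [zero_pow hm]
    simp
  · simp

/-- Completes the triangle `i + j ≤ k` to a square, the added terms being zero. -/
theorem sum_range_antidiagonal {M : Type*} [AddCommMonoid M] (k : ℕ) (t : ℕ → ℕ → M)
    (ht : ∀ i j, k < i + j → t i j = 0) :
    ∑ m ∈ Finset.range (k + 1), ∑ ij ∈ Finset.HasAntidiagonal.antidiagonal m, t ij.1 ij.2 =
      ∑ i ∈ Finset.range (k + 1), ∑ j ∈ Finset.range (k + 1), t i j := by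
  rw [← Finset.sum_product']
  set s := (Finset.range (k + 1) ×ˢ Finset.range (k + 1)).filter fun ij => ij.1 + ij.2 ≤ k
  have h1 : ∑ ij ∈ s, t ij.1 ij.2 =
      ∑ ij ∈ Finset.range (k + 1) ×ˢ Finset.range (k + 1), t ij.1 ij.2 := by
    refine Finset.sum_subset (Finset.filter_subset _ _) fun ij h1 h2 => ht _ _ ?_
    by_contra hcon
    exact h2 (Finset.mem_filter.2 ⟨h1, not_lt.1 hcon⟩)
  rw [← h1, ← Finset.sum_fiberwise_of_maps_to (s := s) (t := Finset.range (k + 1))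
    (g := fun ij => ij.1 + ij.2)]
  · refine Finset.sum_congr rfl fun m hm => Finset.sum_congr ?_ fun _ _ => rfl
    ext ⟨i, j⟩
    simp only [s, Finset.HasAntidiagonal.mem_antidiagonal, Finset.mem_filter, Finset.mem_product,
      Finset.mem_range] at hm ⊢
    omega
  · intro ij hij
    have := (Finset.mem_filter.1 hij).2
    simp only [Finset.mem_range]
    omega

open PowerSeries in
/-- The formal exponential turns commuting sums into products. -/
theorem formalExp_add {F G : PowerSeries R} (hF : coeff 0 F = 0) (hG : coeff 0 G = 0)
    (h : Commute F G) : formalExp (F + G) = formalExp F * formalExp G := by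
  ext k
  have hlow : ∀ i j, k < i + j → coeff k (F ^ i * G ^ j) = 0 := fun i j hij => by
    rw [coeff_mul]
    refine Finset.sum_eq_zero fun pq hpq => ?_
    rw [Finset.HasAntidiagonal.mem_antidiagonal] at hpq
    rcases lt_or_ge pq.1 i with h | h
    · rw [coeff_pow_eq_zero_of_lt hF _ _ h, zero_mul]
    · rw [coeff_pow_eq_zero_of_lt hG j _ (by omega), mul_zero]
  have h1 : coeff k (formalExp (F + G)) = ∑ m ∈ Finset.range (k + 1),
      ∑ ij ∈ Finset.HasAntidiagonal.antidiagonal m,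
        (((ij.1.factorial : ℝ)⁻¹) * ((ij.2.factorial : ℝ)⁻¹)) • coeff k (F ^ ij.1 * G ^ ij.2) := by
    rw [formalExp, coeff_mk]
    refine Finset.sum_congr rfl fun m _ => ?_
    rw [h.add_pow', map_sum, Finset.smul_sum]
    refine Finset.sum_congr rfl fun ij hij => ?_
    rw [Finset.HasAntidiagonal.mem_antidiagonal] at hij
    rw [map_nsmul, ← Nat.cast_smul_eq_nsmul ℝ, smul_smul]
    congr 1
    -- For `i + j = m`, the binomial coefficient divided by `m!` is `1 / (i! j!)`.
    have := Nat.add_choose_mul_factorial_mul_factorial ij.1 ij.2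
    rw [hij, ← Nat.choose_symm_of_eq_add (n := m) (a := ij.1) (b := ij.2) hij.symm] at this
    have h3 : (m.factorial : ℝ) ≠ 0 := by positivity
    have h1 : (ij.1.factorial : ℝ) ≠ 0 := by positivity
    have h2 : (ij.2.factorial : ℝ) ≠ 0 := by positivity
    field_simp
    rw [← this]
    push_cast
    ring
  rw [h1, sum_range_antidiagonal k (fun i j =>
    (((i.factorial : ℝ)⁻¹) * ((j.factorial : ℝ)⁻¹)) • coeff k (F ^ i * G ^ j))
    (fun i j hij => by rw [hlow i j hij, smul_zero]), coeff_mul]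
  have h2 : ∀ pq ∈ Finset.HasAntidiagonal.antidiagonal k,
      coeff pq.1 (formalExp F) * coeff pq.2 (formalExp G) =
        ∑ i ∈ Finset.range (k + 1), ∑ j ∈ Finset.range (k + 1),
          (((i.factorial : ℝ)⁻¹) * ((j.factorial : ℝ)⁻¹)) •
            (coeff pq.1 (F ^ i) * coeff pq.2 (G ^ j)) := fun pq hpq => by
    rw [Finset.HasAntidiagonal.mem_antidiagonal] at hpq
    rw [coeff_formalExp hF (show pq.1 < k + 1 by omega),
      coeff_formalExp hG (show pq.2 < k + 1 by omega), Finset.sum_mul_sum]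
    refine Finset.sum_congr rfl fun i _ => Finset.sum_congr rfl fun j _ => ?_
    rw [smul_mul_smul_comm]
  rw [Finset.sum_congr rfl h2,
    Finset.sum_comm (s := Finset.HasAntidiagonal.antidiagonal k)]
  refine Finset.sum_congr rfl fun i _ => ?_
  rw [Finset.sum_comm (s := Finset.HasAntidiagonal.antidiagonal k)]
  refine Finset.sum_congr rfl fun j _ => ?_
  rw [coeff_mul, Finset.smul_sum]

open PowerSeries in
/-- For an odd series `F`, the series `exp (-F)` arises from `exp F` by the substitution of `-h`
for `h`. -/
theorem coeff_formalExp_neg {F : PowerSeries R} (hF : ∀ n, Even n → coeff n F = 0) (k : ℕ) :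
    coeff k (formalExp (-F)) = (-1 : ℝ) ^ k • coeff k (formalExp F) := by
  have hpow : ∀ m k, coeff k ((-F) ^ m) = (-1 : ℝ) ^ k • coeff k (F ^ m) := by
    intro m
    induction m with
    | zero =>
      intro k
      rw [pow_zero, pow_zero, coeff_one]
      split_ifs with h
      · simp [h]
      · simp
    | succ m ih =>
      intro k
      rw [pow_succ, pow_succ, coeff_mul, coeff_mul, Finset.smul_sum]
      refine Finset.sum_congr rfl fun ij hij => ?_
      rw [Finset.HasAntidiagonal.mem_antidiagonal] at hij
      rw [ih, ← hij, pow_add, ← smul_mul_smul_comm]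
      congr 1
      rw [map_neg]
      rcases Nat.even_or_odd ij.2 with h | h
      · rw [hF _ h]; simp
      · rw [h.neg_one_pow]; simp
  rw [formalExp, formalExp, coeff_mk, coeff_mk, Finset.smul_sum]
  refine Finset.sum_congr rfl fun m _ => ?_
  rw [hpow, smul_comm]

open PowerSeries in
-- Coefficientwise form of `exp F * exp (-F) = 1`, where oddness of `F` makes `exp (-F)` the series
-- `exp F` at `-h`.
theorem sum_antidiagonal_formalExp_odd {F : PowerSeries R}
    (hF : ∀ n, Even n → coeff n F = 0) {n : ℕ} (hn : n ≠ 0) :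
    ∑ ij ∈ Finset.HasAntidiagonal.antidiagonal n,
      (-1 : ℝ) ^ ij.2 • (coeff ij.1 (formalExp F) * coeff ij.2 (formalExp F)) = 0 := by
  have h0 : coeff 0 F = 0 := hF 0 (by simp)
  have h := formalExp_add h0 (G := -F) (by rw [map_neg, h0, neg_zero]) (Commute.refl F).neg_right
  rw [add_neg_cancel, formalExp_zero] at h
  have h1 := congrArg (coeff n) h
  rw [coeff_one, if_neg hn, coeff_mul] at h1
  rw [h1]
  refine Finset.sum_congr rfl fun ij _ => ?_
  rw [coeff_formalExp_neg hF, mul_smul_comm]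

open PowerSeries in
theorem coeff_formalExp_congr {F G : PowerSeries R} {n : ℕ}
    (h : ∀ k < n, coeff k F = coeff k G) {k : ℕ} (hk : k < n) :
    coeff k (formalExp F) = coeff k (formalExp G) := by
  rw [formalExp, formalExp, coeff_mk, coeff_mk]
  exact Finset.sum_congr rfl fun m _ => by rw [coeff_pow_congr h m k hk]

open PowerSeries in
/-- The highest coefficient enters linearly into the formal exponential. -/
theorem coeff_formalExp_sub {F G : PowerSeries R} (hF : coeff 0 F = 0) (hG : coeff 0 G = 0)
    {n : ℕ} (hn : n ≠ 0) (h : ∀ k < n, coeff k F = coeff k G) :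
    coeff n (formalExp F) - coeff n (formalExp G) = coeff n F - coeff n G := by
  rw [formalExp, formalExp, coeff_mk, coeff_mk, ← Finset.sum_sub_distrib]
  -- For `m ≥ 2`, a product of total degree `n` involves only coefficients below `n`, unless a
  -- factor of degree zero kills it. So only `m = 1` sees the coefficients in degree `n`.
  rw [Finset.sum_eq_single 1]
  · simp
  · intro m _ hm
    rw [← smul_sub]
    rcases m with _ | _ | m
    · simp
    · exact absurd rfl hm
    · rw [pow_succ F, pow_succ G, coeff_mul, coeff_mul, ← Finset.sum_sub_distrib,
        Finset.sum_eq_zero, smul_zero]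
      intro ij hij
      rw [Finset.HasAntidiagonal.mem_antidiagonal] at hij
      by_cases h1 : ij.1 < n
      · by_cases h2 : ij.2 < n
        · rw [coeff_pow_congr h _ _ h1, h _ h2, sub_self]
        · rw [show ij.1 = 0 by omega, coeff_pow_eq_zero_of_lt hF _ 0 (by omega),
            coeff_pow_eq_zero_of_lt hG _ 0 (by omega)]
          simp
      · rw [show ij.2 = 0 by omega, hF, hG]
        simp
  · intro h1
    simp at h1
    omega

open PowerSeries in
theorem coeff_zero_formalExp (F : PowerSeries R) : coeff 0 (formalExp F) = 1 := by
  rw [formalExp, coeff_mk]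
  simp

open PowerSeries in
theorem coeff_formalExp_C_mul_X (B : R) (k : ℕ) :
    coeff k (formalExp (C B * X)) = ((k.factorial : ℝ)⁻¹) • B ^ k := by
  rw [formalExp, coeff_mk, Finset.sum_eq_single k]
  · rw [(commute_X (C B)).mul_pow, ← map_pow, coeff_C_mul_X_pow, if_pos rfl]
  · intro m _ hm
    rw [(commute_X (C B)).mul_pow, ← map_pow, coeff_C_mul_X_pow, if_neg hm.symm, smul_zero]
  · simp

open PowerSeries in
theorem coeff_one_formalExp {F : PowerSeries R} (hF : coeff 0 F = 0) :
    coeff 1 (formalExp F) = coeff 1 F := by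
  have h := coeff_formalExp_sub hF (map_zero (coeff 0)) one_ne_zero
    (fun k hk => by rw [Nat.lt_one_iff.1 hk, hF, map_zero])
  rwa [formalExp_zero, coeff_one, if_neg one_ne_zero, map_zero, sub_zero, sub_zero] at h

open PowerSeries in
-- `F` agrees with its linear part `F₁ h` through degree two, so the exponentials differ in degree
-- three exactly by `F₃`.
theorem coeff_three_formalExp {F : PowerSeries R} (hF : coeff 0 F = 0) (hF2 : coeff 2 F = 0) :
    coeff 3 (formalExp F) = (((3 : ℕ).factorial : ℝ)⁻¹) • coeff 1 F ^ 3 + coeff 3 F := by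
  have h : ∀ k, coeff k (C (coeff 1 F) * X) = if k = 1 then coeff 1 F else 0 := fun k => by
    simpa only [pow_one] using coeff_C_mul_X_pow (coeff 1 F) 1 k
  have h1 := coeff_formalExp_sub (F := F) (G := C (coeff 1 F) * X) (n := 3) hF
    (by rw [h, if_neg zero_ne_one]) (by norm_num) (fun k hk => by
      rw [h]
      interval_cases k
      · rw [hF, if_neg (by decide)]
      · rw [if_pos rfl]
      · rw [hF2, if_neg (by decide)])
  rw [h, coeff_formalExp_C_mul_X, if_neg (by decide), sub_zero] at h1
  rw [← h1]
  abel

open PowerSeries in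
-- The top coefficient enters additively, so it can be chosen to give `exp F` a prescribed value in
-- degree `n`.
theorem coeff_formalExp_eq_of_coeff_eq {F G : PowerSeries R} (hF : coeff 0 F = 0)
    (hG : coeff 0 G = 0) {n : ℕ} (hn : n ≠ 0) (h : ∀ k < n, coeff k F = coeff k G) {Z : R}
    (hZ : coeff n F = Z - coeff n (formalExp G) + coeff n G) : coeff n (formalExp F) = Z := by
  have h1 := coeff_formalExp_sub hF hG hn h
  rw [hZ, add_sub_cancel_right, sub_left_inj] at h1
  exact h1

theorem sum_antidiagonal_eq_add {M : Type*} [AddCommMonoid M] {n : ℕ} (hn : n ≠ 0)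
    (t : ℕ × ℕ → M) (ht : ∀ i j, i + j = n → i ≠ 0 → j ≠ 0 → t (i, j) = 0) :
    ∑ ij ∈ Finset.HasAntidiagonal.antidiagonal n, t ij = t (n, 0) + t (0, n) := by
  have hne : (n, 0) ≠ (0, n) := fun h => hn (congrArg Prod.fst h)
  rw [← Finset.sum_pair hne]
  refine (Finset.sum_subset ?_ ?_).symm
  · intro ij hij
    rw [Finset.mem_insert, Finset.mem_singleton] at hij
    rw [Finset.HasAntidiagonal.mem_antidiagonal]
    rcases hij with rfl | rfl <;> simp
  · rintro ⟨i, j⟩ hij hnot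
    rw [Finset.HasAntidiagonal.mem_antidiagonal] at hij
    simp only [Finset.mem_insert, Finset.mem_singleton, Prod.mk.injEq, not_or] at hnot
    simp only at hij
    exact ht i j hij (by omega) (by omega)

/-- The coefficients of even degree of a symmetric series are determined by those of lower
degree. -/
theorem eq_of_symmetric_of_even {S S' : ℕ → R} {n : ℕ} (hn : n ≠ 0) (hev : Even n)
    (h0 : S 0 = 1) (h : ∀ k < n, S k = S' k)
    (hS : ∑ ij ∈ Finset.HasAntidiagonal.antidiagonal n,
      (-1 : ℝ) ^ ij.2 • (S ij.1 * S ij.2) = 0)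
    (hS' : ∑ ij ∈ Finset.HasAntidiagonal.antidiagonal n,
      (-1 : ℝ) ^ ij.2 • (S' ij.1 * S' ij.2) = 0) : S n = S' n := by
  have h0' : S' 0 = 1 := (h 0 (Nat.pos_of_ne_zero hn)).symm.trans h0
  have h3 := sub_eq_zero.2 (hS.trans hS'.symm)
  rw [← Finset.sum_sub_distrib, sum_antidiagonal_eq_add hn] at h3
  -- Only the two end terms survive; for even `n` they carry the same sign and add up to `2 (S n -
  -- S' n)`.
  · simp only [h0, h0', hev.neg_one_pow, pow_zero, mul_one, one_mul, one_smul] at h3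
    rw [← two_smul ℝ, smul_eq_zero] at h3
    exact sub_eq_zero.1 (h3.resolve_left two_ne_zero)
  · intro i j hij hi hj
    simp only
    rw [h i (by omega), h j (by omega), sub_self]

end FormalExp

section Derivations

variable {A : Type*} [AddCommGroup A] [Module ℝ A]

open PowerSeries TensorProduct in
/-- The formal exponential of a series of derivations of a bilinear operation is multiplicative. -/
theorem formalExp_apply_bilinear (μ : A →ₗ[ℝ] A →ₗ[ℝ] A) {L : PowerSeries (Module.End ℝ A)}
    (hL0 : coeff 0 L = 0)
    (hL : ∀ n f g, coeff n L (μ f g) = μ (coeff n L f) g + μ f (coeff n L g))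
    (n : ℕ) (f g : A) :
    coeff n (formalExp L) (μ f g) = ∑ ij ∈ Finset.HasAntidiagonal.antidiagonal n,
      μ (coeff ij.1 (formalExp L) f) (coeff ij.2 (formalExp L) g) := by
  -- `L ⊗ 1` and `1 ⊗ L` commute on `A ⊗ A`, and by the Leibniz rule the map `M` induced by `μ`
  -- intertwines their sum with `L`. Hence `exp L ∘ M = M ∘ (exp (L ⊗ 1) exp (1 ⊗ L))`.
  let ι₁ := (Module.End.rTensorAlgHom ℝ A A)
  let ι₂ := (Module.End.lTensorAlgHom ℝ A A)
  let L₁ := PowerSeries.map ι₁.toRingHom L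
  let L₂ := PowerSeries.map ι₂.toRingHom L
  have h₁ : coeff 0 L₁ = 0 := by
    rw [coeff_map, hL0, map_zero]
  have h₂ : coeff 0 L₂ = 0 := by
    rw [coeff_map, hL0, map_zero]
  have hc : ∀ S S' : Module.End ℝ A, ι₁ S * ι₂ S' = ι₂ S' * ι₁ S := fun S S' => by
    apply TensorProduct.ext'
    intro x y
    rfl
  have hcomm : Commute L₁ L₂ := by
    ext1 k
    rw [coeff_mul, coeff_mul, ← Finset.Nat.sum_antidiagonal_swap]
    refine Finset.sum_congr rfl fun ij _ => ?_
    rw [coeff_map, coeff_map, coeff_map, coeff_map]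
    exact hc _ _
  let M : A ⊗[ℝ] A →ₗ[ℝ] A := TensorProduct.lift μ
  have hM : ∀ k z, M (coeff k (L₁ + L₂) z) = coeff k L (M z) := by
    intro k z
    have : M ∘ₗ (coeff k (L₁ + L₂)) = coeff k L ∘ₗ M := by
      apply TensorProduct.ext'
      intro x y
      have e1 : coeff k (L₁ + L₂) (x ⊗ₜ[ℝ] y) =
          (coeff k L x) ⊗ₜ[ℝ] y + x ⊗ₜ[ℝ] (coeff k L y) := by
        rw [map_add, coeff_map, coeff_map]
        rfl
      rw [LinearMap.comp_apply, LinearMap.comp_apply, e1, map_add]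
      simp only [M, TensorProduct.lift.tmul]
      rw [hL]
    exact LinearMap.congr_fun this z
  have hMpow : ∀ (m k : ℕ) (z : A ⊗[ℝ] A), M (coeff k ((L₁ + L₂) ^ m) z) = coeff k (L ^ m) (M z) := by
    intro m
    induction m with
    | zero =>
      intro k z
      rw [pow_zero, pow_zero, coeff_one, coeff_one]
      split_ifs <;> simp
    | succ m ih =>
      intro k z
      rw [pow_succ, pow_succ, coeff_mul, coeff_mul, LinearMap.sum_apply, LinearMap.sum_apply,
        map_sum]
      refine Finset.sum_congr rfl fun ij _ => ?_
      rw [Module.End.mul_apply, Module.End.mul_apply, ih, hM]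
  have hMexp : ∀ (k : ℕ) (z : A ⊗[ℝ] A), M (coeff k (formalExp (L₁ + L₂)) z) = coeff k (formalExp L) (M z) := by
    intro k z
    rw [formalExp, formalExp, coeff_mk, coeff_mk, LinearMap.sum_apply, LinearMap.sum_apply,
      map_sum]
    refine Finset.sum_congr rfl fun m _ => ?_
    rw [LinearMap.smul_apply, LinearMap.smul_apply, map_smul, hMpow]
  have key := hMexp n (f ⊗ₜ[ℝ] g)
  rw [formalExp_add h₁ h₂ hcomm, formalExp_map, formalExp_map, coeff_mul, LinearMap.sum_apply,
    map_sum] at key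
  simp only [M, TensorProduct.lift.tmul] at key
  rw [← key]
  refine Finset.sum_congr rfl fun ij _ => ?_
  rw [coeff_map, coeff_map]
  rfl

end Derivations

end SplittingFlow

/-! ### Hadamard's lemma, and derivations of smooth functions as vector fields. -/

namespace SplittingFlow

section ParametricIntegral

variable {E : Type} [NormedAddCommGroup E] [NormedSpace ℝ E] [FiniteDimensional ℝ E]

/-- Differentiation under the integral sign; finite dimension makes closed balls compact, so the
derivative is dominated by a constant. -/
theorem hasFDerivAt_integral_of_contDiff {F : Type} [NormedAddCommGroup F] [NormedSpace ℝ F]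
    {G : E × ℝ → F} (hG : ContDiff ℝ 1 G) (y : E) :
    HasFDerivAt (fun y => ∫ t in (0 : ℝ)..1, G (y, t))
      (∫ t in (0 : ℝ)..1, (fderiv ℝ G (y, t)).comp (ContinuousLinearMap.inl ℝ E ℝ)) y := by
  have hG' : Continuous (fderiv ℝ G) := hG.continuous_fderiv (by norm_num)
  have hF' : Continuous fun q : E × ℝ =>
      (fderiv ℝ G q).comp (ContinuousLinearMap.inl ℝ E ℝ) := by fun_prop
  have := FiniteDimensional.proper_real E
  obtain ⟨C, hC⟩ := ((isCompact_closedBall y 1).prod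
    (isCompact_Icc (a := (0 : ℝ)) (b := 1))).exists_bound_of_continuousOn hF'.continuousOn
  refine intervalIntegral.hasFDerivAt_integral_of_dominated_of_fderiv_le
    (F := fun y t => G (y, t))
    (F' := fun y t => (fderiv ℝ G (y, t)).comp (ContinuousLinearMap.inl ℝ E ℝ))
    (bound := fun _ => C) (Metric.closedBall_mem_nhds y one_pos) ?_ ?_ ?_ ?_ ?_ ?_
  · refine Eventually.of_forall fun x => Continuous.aestronglyMeasurable ?_
    exact hG.continuous.comp (by fun_prop)
  · exact (hG.continuous.comp (by fun_prop : Continuous fun t : ℝ => (y, t))).intervalIntegrable _ _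
  · exact (hF'.comp (by fun_prop : Continuous fun t : ℝ => (y, t))).aestronglyMeasurable
  · refine Eventually.of_forall fun t ht x hx => hC (x, t) ⟨hx, ?_⟩
    rw [Set.uIoc_of_le zero_le_one] at ht
    exact Set.Ioc_subset_Icc_self ht
  · exact intervalIntegrable_const
  · refine Eventually.of_forall fun t _ x _ => ?_
    exact ((hG.differentiable (by norm_num)) (x, t)).hasFDerivAt.comp x
      (hasFDerivAt_prodMk_left x t)

theorem contDiff_integral_nat {F : Type} [NormedAddCommGroup F] [NormedSpace ℝ F]
    (n : ℕ) {G : E × ℝ → F} (hG : ContDiff ℝ n G) :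
    ContDiff ℝ n fun y => ∫ t in (0 : ℝ)..1, G (y, t) := by
  -- The codomain must vary, since the derivative takes values in `E →L[ℝ] F`.
  induction n generalizing F with
  | zero =>
    rw [Nat.cast_zero, contDiff_zero] at hG ⊢
    exact intervalIntegral.continuous_parametric_intervalIntegral_of_continuous'
      (f := fun y t => G (y, t)) hG 0 1
  | succ n ih =>
    have : ContDiff ℝ n (fderiv ℝ G) := hG.fderiv_right (by norm_cast)
    exact contDiff_succ_iff_hasFDerivAt.2 ⟨_,
      ih (G := fun q => (fderiv ℝ G q).comp (ContinuousLinearMap.inl ℝ E ℝ))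
        (this.clm_comp contDiff_const),
      hasFDerivAt_integral_of_contDiff (hG.of_le (by norm_cast; omega))⟩

theorem contDiff_integral {F : Type} [NormedAddCommGroup F] [NormedSpace ℝ F]
    {G : E × ℝ → F} (hG : ContDiff ℝ ∞ G) :
    ContDiff ℝ ∞ fun y => ∫ t in (0 : ℝ)..1, G (y, t) :=
  contDiff_infty.2 fun n => contDiff_integral_nat n (contDiff_infty.1 hG n)

/-- Hadamard's lemma. -/
theorem exists_smooth_slope {g : E → ℝ} (hg : ContDiff ℝ ∞ g) (x : E) :
    ∃ Λ : E → E →L[ℝ] ℝ, ContDiff ℝ ∞ Λ ∧ Λ x = fderiv ℝ g x ∧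
      ∀ y, g y = g x + Λ y (y - x) := by
  have hg' : ContDiff ℝ ∞ (fderiv ℝ g) := hg.fderiv_right (by norm_num)
  have hG : ContDiff ℝ ∞ fun q : E × ℝ => fderiv ℝ g (x + q.2 • (q.1 - x)) :=
    hg'.comp (by fun_prop)
  -- `Λ y` is the average of `fderiv ℝ g` over the segment from `x` to `y`.
  refine ⟨_, contDiff_integral hG, by simp, fun y => ?_⟩
  have hline : Continuous fun t : ℝ => fderiv ℝ g (x + t • (y - x)) :=
    hg'.continuous.comp (by fun_prop)
  have h1 : ∀ t ∈ Set.uIcc (0 : ℝ) 1, HasDerivAt (fun t : ℝ => g (x + t • (y - x)))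
      (fderiv ℝ g (x + t • (y - x)) (y - x)) t := fun t _ => by
    refine ((hg.differentiable (by simp)) _).hasFDerivAt.comp_hasDerivAt t ?_
    simpa using ((hasDerivAt_id t).smul_const (y - x)).const_add x
  have h2 := intervalIntegral.integral_eq_sub_of_hasDerivAt h1
    ((hline.clm_apply continuous_const).intervalIntegrable _ _)
  rw [ContinuousLinearMap.intervalIntegral_apply (hline.intervalIntegrable _ _)]
  simp only [h2, one_smul, zero_smul, add_zero]
  rw [add_sub_cancel x y]
  ring

end ParametricIntegral

section Derivations

variable {D : ℕ}

/-- The product of smooth functions. -/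
noncomputable def smoothMul (D : ℕ) : SmoothFun D →ₗ[ℝ] SmoothFun D →ₗ[ℝ] SmoothFun D :=
  LinearMap.mk₂ ℝ
    (fun f g => ⟨fun x => f.1 x * g.1 x, (SmoothFun.contDiff f).mul (SmoothFun.contDiff g)⟩)
    (fun f f' g => by ext x; exact add_mul _ _ _)
    (fun c f g => by ext x; exact mul_assoc _ _ _)
    (fun f g g' => by ext x; exact mul_add _ _ _)
    (fun c f g => by ext x; exact mul_left_comm _ _ _)

@[simp]
theorem smoothMul_apply (f g : SmoothFun D) (x : Phase D) :
    (smoothMul D f g).1 x = f.1 x * g.1 x := rfl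

@[simp]
theorem lieOp_apply (v : SmoothVectorField D) (g : SmoothFun D) (x : Phase D) :
    (lieOp v g).1 x = fderiv ℝ g.1 x (v.1 x) := rfl

theorem lieOp_smoothMul (v : SmoothVectorField D) (f g : SmoothFun D) :
    lieOp v (smoothMul D f g) = smoothMul D (lieOp v f) g + smoothMul D f (lieOp v g) := by
  ext x
  change fderiv ℝ (fun x => f.1 x * g.1 x) x (v.1 x) =
    fderiv ℝ f.1 x (v.1 x) * g.1 x + f.1 x * fderiv ℝ g.1 x (v.1 x)
  rw [fderiv_fun_mul (SmoothFun.differentiableAt f x) (SmoothFun.differentiableAt g x)]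
  simp only [add_apply, smul_apply, smul_eq_mul]
  ring

/-- The coordinate functions. -/
noncomputable def coordFun (i : Fin D) : SmoothFun D :=
  ⟨fun x => x i, (contDiff_piLp_apply (p := 2) : ContDiff ℝ ∞ fun x : Phase D => x i)⟩

@[simp]
theorem coordFun_apply (i : Fin D) (x : Phase D) : (coordFun i).1 x = x i := rfl

/-- The constant functions. -/
noncomputable def constFun (D : ℕ) (c : ℝ) : SmoothFun D :=
  ⟨fun _ => c, (contDiff_const : ContDiff ℝ ∞ fun _ : Phase D => c)⟩

/-- The vector field whose coordinates are given smooth functions. -/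
noncomputable def vectorFieldOfCoords (c : Fin D → SmoothFun D) : SmoothVectorField D :=
  ⟨fun x => WithLp.toLp 2 fun i => (c i).1 x,
    contDiff_euclidean.2 fun i => SmoothFun.contDiff (c i)⟩

@[simp]
theorem vectorFieldOfCoords_apply (c : Fin D → SmoothFun D) (x : Phase D) (i : Fin D) :
    (vectorFieldOfCoords c).1 x i = (c i).1 x := rfl

theorem clm_apply_eq_sum (Λ : Phase D →L[ℝ] ℝ) (x : Phase D) :
    Λ x = ∑ i, x i * Λ (EuclideanSpace.single i 1) := by
  conv_lhs => rw [← (EuclideanSpace.basisFun (Fin D) ℝ).sum_repr x]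
  simp [map_sum]

/-- A derivation of the smooth functions is the Lie operator of a smooth vector field. -/
theorem eq_lieOp_of_derivation (T : Module.End ℝ (SmoothFun D))
    (hT : ∀ f g, T (smoothMul D f g) = smoothMul D (T f) g + smoothMul D f (T g)) :
    T = lieOp (vectorFieldOfCoords fun i => T (coordFun i)) := by
  have hone : T (constFun D 1) = 0 := by
    have h1 := hT (constFun D 1) (constFun D 1)
    have h2 : smoothMul D (constFun D 1) (constFun D 1) = constFun D 1 := by
      ext x; exact mul_one _
    have h3 : smoothMul D (T (constFun D 1)) (constFun D 1) = T (constFun D 1) := by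
      ext x; exact mul_one _
    have h4 : smoothMul D (constFun D 1) (T (constFun D 1)) = T (constFun D 1) := by
      ext x; exact one_mul _
    rw [h2, h3, h4] at h1
    simpa using h1
  have hconst : ∀ c, T (constFun D c) = 0 := fun c => by
    have : constFun D c = c • constFun D 1 := by
      ext x; exact (mul_one c).symm
    rw [this, map_smul, hone, smul_zero]
  ext g x
  obtain ⟨Λ, hΛ, hx, hgΛ⟩ := exists_smooth_slope (SmoothFun.contDiff g) x
  let k : Fin D → SmoothFun D := fun i =>
    ⟨fun y => Λ y (EuclideanSpace.single i 1), hΛ.clm_apply contDiff_const⟩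
  -- A derivation kills the constant, and at `x` the factors `yᵢ - xᵢ` vanish. What remains is the
  -- sum of `T` of the coordinates times `k i` at `x`, which is the `i`-th partial derivative of
  -- `g`.
  have hg : g = constFun D (g.1 x) +
      ∑ i, smoothMul D (coordFun i - constFun D (x i)) (k i) := by
    ext y
    have e1 : (constFun D (g.1 x) +
      ∑ i, smoothMul D (coordFun i - constFun D (x i)) (k i)).1 y =
        g.1 x + ∑ i, (y i - x i) * Λ y (EuclideanSpace.single i 1) := by
      rw [Submodule.coe_add, Pi.add_apply, Submodule.coe_sum, Finset.sum_apply]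
      rfl
    rw [e1, hgΛ y, clm_apply_eq_sum]
    rfl
  have hTg : T g = ∑ i, (smoothMul D (T (coordFun i)) (k i) +
      smoothMul D (coordFun i - constFun D (x i)) (T (k i))) := by
    conv_lhs => rw [hg]
    rw [map_add, hconst, zero_add, map_sum]
    refine Finset.sum_congr rfl fun i _ => ?_
    rw [hT, map_sub, hconst, sub_zero]
  rw [lieOp_apply, ← hx, clm_apply_eq_sum, hTg, Submodule.coe_sum, Finset.sum_apply]
  refine Finset.sum_congr rfl fun i _ => ?_
  change (T (coordFun i)).1 x * Λ x (EuclideanSpace.single i 1) +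
    (x i - x i) * (T (k i)).1 x = _
  rw [sub_self, zero_mul, add_zero]
  rfl

end Derivations

end SplittingFlow

/-! ### Taylor operators of a one-parameter family of maps. -/

namespace SplittingFlow

variable {D : ℕ}

section Coefficients

/-- Collecting the powers of `h` in a double sum, up to higher order terms. -/
theorem double_sum_isBigO (N : ℕ) (t : ℕ → ℕ → ℝ) :
    (fun h : ℝ => ∑ i ∈ Finset.range (N + 1), ∑ j ∈ Finset.range (N + 1), h ^ (i + j) * t i j -
      ∑ n ∈ Finset.range (N + 1), h ^ n *
        ∑ ij ∈ Finset.HasAntidiagonal.antidiagonal n, t ij.1 ij.2)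
      =O[𝓝 0] fun h : ℝ => h ^ (N + 1) := by
  have h1 : ∀ h : ℝ, ∑ n ∈ Finset.range (N + 1), h ^ n *
      ∑ ij ∈ Finset.HasAntidiagonal.antidiagonal n, t ij.1 ij.2 =
      ∑ i ∈ Finset.range (N + 1), ∑ j ∈ Finset.range (N + 1),
        if i + j ≤ N then h ^ (i + j) * t i j else 0 := fun h => by
    rw [← sum_range_antidiagonal N (fun i j => if i + j ≤ N then h ^ (i + j) * t i j else 0)
      (fun i j hij => if_neg (not_le.2 hij))]
    refine Finset.sum_congr rfl fun n hn => ?_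
    rw [Finset.mul_sum]
    refine Finset.sum_congr rfl fun ij hij => ?_
    rw [Finset.HasAntidiagonal.mem_antidiagonal] at hij
    rw [Finset.mem_range] at hn
    rw [if_pos (by omega), hij]
  simp only [h1, ← Finset.sum_sub_distrib]
  refine IsBigO.fun_sum fun i _ => IsBigO.fun_sum fun j _ => ?_
  by_cases hij : i + j ≤ N
  · simp only [if_pos hij, sub_self]
    exact isBigO_zero _ _
  · simp only [if_neg hij, sub_zero]
    have h2 : (fun h : ℝ => h ^ (i + j)) =O[𝓝 0] fun h : ℝ => h ^ (N + 1) :=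
      IsBigO.of_bound 1 (by
        filter_upwards [Metric.ball_mem_nhds (0 : ℝ) one_pos] with h hh
        rw [one_mul, norm_pow, norm_pow]
        exact pow_le_pow_of_le_one (norm_nonneg h) (by simpa using (Metric.mem_ball.1 hh).le)
          (by omega))
    exact (h2.const_mul_left (t i j)).congr_left fun h => mul_comm _ _

/-- The coefficients of an asymptotic expansion are unique. -/
theorem expansion_unique {G : ℝ → ℝ} {c c' : ℕ → ℝ} {N : ℕ}
    (h : (fun t => G t - ∑ k ∈ Finset.range (N + 1), t ^ k * c k) =O[𝓝 0] fun t => t ^ (N + 1))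
    (h' : (fun t => G t - ∑ k ∈ Finset.range (N + 1), t ^ k * c' k)
      =O[𝓝 0] fun t => t ^ (N + 1)) {k : ℕ} (hk : k ≤ N) : c k = c' k := by
  refine sub_eq_zero.1 (coeff_eq_zero_of_isBigO N (fun k => c k - c' k) ?_ k hk)
  refine ((h'.sub h).mono nhdsWithin_le_nhds).congr_left fun t => ?_
  simp only [mul_sub, Finset.sum_sub_distrib]
  ring

end Coefficients

/-- `X k` are the coefficients of the Taylor expansion of observables along `Φ`, locally uniformly
in the initial value. -/
def HasUniformSeries (Φ : ℝ → Phase D → Phase D) (X : ℕ → Module.End ℝ (SmoothFun D)) : Prop :=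
  ∀ (g : SmoothFun D) (x₀ : Phase D) (N : ℕ),
    (fun p : ℝ × Phase D => g.1 (Φ p.1 p.2) -
        ∑ k ∈ Finset.range (N + 1), p.1 ^ k * (X k g).1 p.2)
      =O[𝓝 (0, x₀)] fun p => p.1 ^ (N + 1)

theorem tendsto_prodMk_const (x : Phase D) :
    Tendsto (fun h : ℝ => (h, x)) (𝓝 0) (𝓝 (0, x)) :=
  (by fun_prop : Continuous fun h : ℝ => (h, x)).tendsto 0

theorem exists_uniform_expansion {χ : ℝ → Phase D → Phase D}
    (hχ : ∀ x : Phase D, ContDiffAt ℝ ∞ (fun p : ℝ × Phase D => χ p.1 p.2) (0, x))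
    (g : SmoothFun D) :
    ∃ c : ℕ → SmoothFun D, ∀ (x₀ : Phase D) (N : ℕ),
      (fun p : ℝ × Phase D => g.1 (χ p.1 p.2) -
        ∑ k ∈ Finset.range (N + 1), p.1 ^ k * (c k).1 p.2)
      =O[𝓝 (0, x₀)] fun p => p.1 ^ (N + 1) := by
  -- `P` is the derivative in time. The iterates `u k` are smooth only near time `0`, but their
  -- restrictions to time `0` are smooth on the whole space.
  let P : (ℝ × Phase D → ℝ) → ℝ × Phase D → ℝ := fun G p => fderiv ℝ G p (1, 0)
  let u : ℕ → ℝ × Phase D → ℝ := fun k => P^[k] fun p => g.1 (χ p.1 p.2)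
  have hsucc : ∀ k, u (k + 1) = P (u k) := fun k => Function.iterate_succ_apply' _ _ _
  have hu : ∀ k x, ContDiffAt ℝ ∞ (u k) (0, x) := by
    intro k
    induction k with
    | zero => exact fun x => (SmoothFun.contDiff g).contDiffAt.comp (0, x) (hχ x)
    | succ k ih =>
      intro x
      rw [hsucc]
      exact ((ih x).fderiv_right (m := ∞) (by norm_num)).clm_apply contDiffAt_const
  refine ⟨fun k => ⟨fun x => (k.factorial : ℝ)⁻¹ * u k (0, x), ?_⟩, fun x₀ N => ?_⟩
  · change ContDiff ℝ ∞ fun x : Phase D => (k.factorial : ℝ)⁻¹ * u k (0, x)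
    refine contDiff_const.mul (contDiff_iff_contDiffAt.2 fun x => ?_)
    have h1 : ContDiff ℝ ∞ fun x : Phase D => ((0 : ℝ), x) := contDiff_prodMk_right 0
    exact (hu k x).comp x h1.contDiffAt
  · have key := taylor_isBigO (y₀ := x₀) (w := fun _ => 1) N u (fun k _ => ?_) ?_
    · simp only [mul_one] at key
      refine key.congr_left fun p => ?_
      simp only [smul_eq_mul, mul_assoc]
      rfl
    · have h1 : ContDiffAt ℝ 1 (u k) (0, x₀) := (hu k x₀).of_le (by exact_mod_cast le_top)
      filter_upwards [h1.eventually (by simp)] with p hp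
      have h2 := (hp.differentiableAt (by norm_num)).hasFDerivAt.comp_hasDerivAt p.1
        ((hasDerivAt_id p.1).prodMk (hasDerivAt_const p.1 p.2))
      rw [hsucc]
      exact h2
    · exact (hu (N + 1) x₀).continuousAt.tendsto.isBigO_one ℝ

/-- Uniqueness of asymptotic expansions makes the coefficients linear in the observable. -/
theorem exists_hasUniformSeries {χ : ℝ → Phase D → Phase D}
    (hχ : ∀ x : Phase D, ContDiffAt ℝ ∞ (fun p : ℝ × Phase D => χ p.1 p.2) (0, x)) :
    ∃ X, HasUniformSeries χ X := by
  choose c hc using exists_uniform_expansion hχ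
  have hc' : ∀ g x N, (fun h : ℝ => g.1 (χ h x) -
      ∑ k ∈ Finset.range (N + 1), h ^ k * (c g k).1 x) =O[𝓝 0] fun h => h ^ (N + 1) :=
    fun g x N => (hc g x N).comp_tendsto (tendsto_prodMk_const x)
  refine ⟨fun k => ⟨⟨fun g => c g k, fun f g => ?_⟩, fun r g => ?_⟩, hc⟩
  · ext x
    refine expansion_unique (hc' (f + g) x k) (c' := fun k => (c f k).1 x + (c g k).1 x) ?_ le_rfl
    refine ((hc' f x k).add (hc' g x k)).congr_left fun h => ?_
    simp only [mul_add, Finset.sum_add_distrib]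
    change _ = f.1 (χ h x) + g.1 (χ h x) - _
    ring
  · ext x
    refine expansion_unique (hc' (r • g) x k) (c' := fun k => r * (c g k).1 x) ?_ le_rfl
    refine ((hc' g x k).const_mul_left r).congr_left fun h => ?_
    rw [mul_sub, Finset.mul_sum]
    change _ = r * g.1 (χ h x) - _
    congr 1
    exact Finset.sum_congr rfl fun k _ => by ring

section Properties

variable {Φ : ℝ → Phase D → Phase D} {X : ℕ → Module.End ℝ (SmoothFun D)}

theorem HasUniformSeries.at_point (hX : HasUniformSeries Φ X) (g : SmoothFun D) (x : Phase D)
    (N : ℕ) : (fun h : ℝ => g.1 (Φ h x) - ∑ k ∈ Finset.range (N + 1), h ^ k * (X k g).1 x)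
      =O[𝓝 0] fun h => h ^ (N + 1) :=
  (hX g x N).comp_tendsto (tendsto_prodMk_const x)

theorem isBigO_one_of_expansion {G : ℝ → ℝ} {c : ℕ → ℝ} {N : ℕ}
    (h : (fun t => G t - ∑ k ∈ Finset.range (N + 1), t ^ k * c k)
      =O[𝓝 0] fun t => t ^ (N + 1)) : G =O[𝓝 0] fun _ => (1 : ℝ) := by
  have h1 : (fun t : ℝ => ∑ k ∈ Finset.range (N + 1), t ^ k * c k) =O[𝓝 0] fun _ => (1 : ℝ) :=
    ((by fun_prop : Continuous fun t : ℝ =>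
      ∑ k ∈ Finset.range (N + 1), t ^ k * c k).tendsto 0).isBigO_one ℝ
  have h2 : (fun t : ℝ => t ^ (N + 1)) =O[𝓝 0] fun _ => (1 : ℝ) :=
    ((continuous_pow (N + 1)).tendsto (0 : ℝ)).isBigO_one ℝ
  exact ((h.trans h2).add h1).congr_left fun t => by ring

/-- The operators of a Taylor expansion are multiplicative. -/
theorem HasUniformSeries.apply_smoothMul (hX : HasUniformSeries Φ X) (n : ℕ)
    (f g : SmoothFun D) :
    X n (smoothMul D f g) = ∑ ij ∈ Finset.HasAntidiagonal.antidiagonal n,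
      smoothMul D (X ij.1 f) (X ij.2 g) := by
  ext x
  rw [Submodule.coe_sum, Finset.sum_apply]
  have hf := hX.at_point f x n
  have hg := hX.at_point g x n
  refine expansion_unique (hX.at_point (smoothMul D f g) x n)
    (c' := fun n => ∑ ij ∈ Finset.HasAntidiagonal.antidiagonal n,
      (X ij.1 f).1 x * (X ij.2 g).1 x) ?_ le_rfl
  -- With `F`, `G` the two functions of `h` and `P`, `Q` their Taylor polynomials, `F G - P Q = (F -
  -- P) G + P (G - Q)`; `double_sum_isBigO` then sorts `P Q` by powers of `h`.
  have h1 := hf.mul (isBigO_one_of_expansion hg)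
  have hP : (fun t : ℝ => ∑ k ∈ Finset.range (n + 1), t ^ k * (X k f).1 x)
      =O[𝓝 0] fun _ => (1 : ℝ) :=
    ((by fun_prop : Continuous fun t : ℝ =>
      ∑ k ∈ Finset.range (n + 1), t ^ k * (X k f).1 x).tendsto 0).isBigO_one ℝ
  have h2 := hP.mul hg
  simp only [mul_one] at h1
  simp only [one_mul] at h2
  refine ((h1.add h2).add (double_sum_isBigO n fun i j => (X i f).1 x * (X j g).1 x)).congr_left
    fun h => ?_
  have e : ∑ i ∈ Finset.range (n + 1), ∑ j ∈ Finset.range (n + 1),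
      h ^ (i + j) * ((X i f).1 x * (X j g).1 x) =
      (∑ k ∈ Finset.range (n + 1), h ^ k * (X k f).1 x) *
        ∑ k ∈ Finset.range (n + 1), h ^ k * (X k g).1 x := by
    rw [Finset.sum_mul_sum]
    exact Finset.sum_congr rfl fun i _ => Finset.sum_congr rfl fun j _ => by ring
  rw [e, smoothMul_apply]
  ring

/-- The operators of a symmetric method. -/
theorem HasUniformSeries.sum_antidiagonal_symm (hX : HasUniformSeries Φ X)
    (ht : ∀ x₀, Tendsto (fun p : ℝ × Phase D => Φ p.1 p.2) (𝓝 (0, x₀)) (𝓝 x₀))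
    (hs : ∀ x₀, ∀ᶠ p in 𝓝 ((0 : ℝ), x₀), Φ (-p.1) (Φ p.1 p.2) = p.2) {n : ℕ} (hn : n ≠ 0) :
    ∑ ij ∈ Finset.HasAntidiagonal.antidiagonal n, (-1 : ℝ) ^ ij.2 • (X ij.1 * X ij.2) = 0 := by
  ext g x
  rw [LinearMap.sum_apply, Submodule.coe_sum, Finset.sum_apply]
  have hlim : Tendsto (fun h : ℝ => (-h, Φ h x)) (𝓝 0) (𝓝 (0, x)) := by
    refine Tendsto.prodMk_nhds ?_ ((ht x).comp (tendsto_prodMk_const x))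
    simpa using (continuous_neg (G := ℝ)).tendsto 0
  -- Expansion at time `-h` from the moving point `Φ h x`: here uniformity in the initial value is
  -- essential.
  have h1 := (hX g x n).comp_tendsto hlim
  have h1' : ((fun p : ℝ × Phase D => p.1 ^ (n + 1)) ∘ fun h : ℝ => (-h, Φ h x))
      =O[𝓝 0] fun h : ℝ => h ^ (n + 1) := by
    refine IsBigO.of_bound 1 (Eventually.of_forall fun h => ?_)
    simp
  -- Each coefficient `X k g` is in turn expanded along `Φ h x`, which produces the products `X j *
  -- X k`.
  have h2 : (fun h : ℝ => ∑ k ∈ Finset.range (n + 1), (-h) ^ k * ((X k g).1 (Φ h x) -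
      ∑ j ∈ Finset.range (n + 1), h ^ j * (X j (X k g)).1 x))
      =O[𝓝 0] fun h : ℝ => h ^ (n + 1) := by
    refine IsBigO.fun_sum fun k _ => ?_
    have hk : (fun h : ℝ => (-h) ^ k) =O[𝓝 0] fun _ => (1 : ℝ) :=
      ((by fun_prop : Continuous fun h : ℝ => (-h) ^ k).tendsto 0).isBigO_one ℝ
    simpa only [one_mul] using hk.mul (hX.at_point (X k g) x n)
  have h3 := double_sum_isBigO n fun j k => (-1 : ℝ) ^ k * (X j (X k g)).1 x
  have key : (fun h : ℝ => g.1 x - ∑ m ∈ Finset.range (n + 1), h ^ m *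
      ∑ ij ∈ Finset.HasAntidiagonal.antidiagonal m, (-1 : ℝ) ^ ij.2 * (X ij.1 (X ij.2 g)).1 x)
      =O[𝓝 0] fun h : ℝ => h ^ (n + 1) := by
    refine (((h1.trans h1').add h2).add h3).congr' ?_ EventuallyEq.rfl
    filter_upwards [(tendsto_prodMk_const x).eventually (hs x)] with h hh
    have hh : Φ (-h) (Φ h x) = x := hh
    have e : ∑ i ∈ Finset.range (n + 1), ∑ j ∈ Finset.range (n + 1),
        h ^ (i + j) * ((-1 : ℝ) ^ j * (X i (X j g)).1 x) =
        ∑ k ∈ Finset.range (n + 1), (-h) ^ k *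
          ∑ j ∈ Finset.range (n + 1), h ^ j * (X j (X k g)).1 x := by
      rw [Finset.sum_comm]
      refine Finset.sum_congr rfl fun k _ => ?_
      rw [Finset.mul_sum]
      refine Finset.sum_congr rfl fun j _ => ?_
      rw [neg_pow h k]
      ring
    rw [e]
    simp only [Function.comp_apply, hh, mul_sub, Finset.sum_sub_distrib]
    ring
  have h0 : (fun h : ℝ => g.1 x - ∑ m ∈ Finset.range (n + 1), h ^ m *
      (if m = 0 then g.1 x else 0)) =O[𝓝 0] fun h : ℝ => h ^ (n + 1) := by
    refine (isBigO_zero _ _).congr_left fun h => ?_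
    rw [Finset.sum_eq_single 0 (by simp +contextual) (by simp)]
    simp
  have := expansion_unique key h0 le_rfl
  rw [if_neg hn] at this
  exact this

theorem HasUniformSeries.zero_eq_one (hX : HasUniformSeries Φ X) (h0 : ∀ x, Φ 0 x = x) :
    X 0 = 1 := by
  ext g x
  -- The error `O(h)` of the expansion of degree zero vanishes at `h = 0` itself.
  obtain ⟨C, hC⟩ := (hX.at_point g x 0).bound
  have h2 := hC.self_of_nhds
  simp only [zero_add, Finset.range_one, Finset.sum_singleton, pow_zero, one_mul, h0, pow_one,
    norm_zero, mul_zero, norm_le_zero_iff] at h2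
  exact (sub_eq_zero.1 h2).symm

/-- Methods which agree up to order `n` have the same operators up to order `n`. -/
theorem HasUniformSeries.congr {Φ' : ℝ → Phase D → Phase D}
    {X' : ℕ → Module.End ℝ (SmoothFun D)} (hX : HasUniformSeries Φ X)
    (hX' : HasUniformSeries Φ' X') {n : ℕ}
    (ht : ∀ x₀, Tendsto (fun p : ℝ × Phase D => Φ p.1 p.2) (𝓝 (0, x₀)) (𝓝 x₀))
    (ht' : ∀ x₀, Tendsto (fun p : ℝ × Phase D => Φ' p.1 p.2) (𝓝 (0, x₀)) (𝓝 x₀))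
    (h : ∀ x, (fun h : ℝ => Φ h x - Φ' h x) =O[𝓝 0] fun h => h ^ (n + 1)) {k : ℕ}
    (hk : k ≤ n) : X k = X' k := by
  ext g x
  refine expansion_unique (hX.at_point g x n) (c' := fun k => (X' k g).1 x) ?_ hk
  have h1 := (isBigO_sub_of_contDiff ((SmoothFun.contDiff g).of_le
    (by exact_mod_cast le_top)) x).comp_tendsto
    (((ht x).comp (tendsto_prodMk_const x)).prodMk_nhds
      ((ht' x).comp (tendsto_prodMk_const x)))
  refine ((h1.trans (h x)).add (hX'.at_point g x n)).congr_left fun h => ?_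
  simp only [Function.comp_apply]
  ring

/-- The expansion of the flow of a vector field is the exponential of its Lie operator. -/
theorem IsLocalFlow.hasUniformSeries {v : SmoothVectorField D} (h : IsLocalFlow v.1 Φ) :
    HasUniformSeries Φ fun k => ((k.factorial : ℝ)⁻¹) • lieOp v ^ k := by
  intro g x₀ N
  have ht := h.tendsto v.2.continuous x₀
  have key := taylor_isBigO (y₀ := x₀) (w := fun _ => 1) N
    (fun k p => ((lieOp v ^ k) g).1 (Φ p.1 p.2)) (fun k _ => ?_) ?_
  · simp only [mul_one] at key
    refine key.congr' ?_ EventuallyEq.rfl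
    have e1 := ((continuous_const (y := (0 : ℝ))).prodMk continuous_snd).tendsto
      ((0 : ℝ), x₀) |>.eventually (h x₀)
    filter_upwards [e1] with p h1
    have h1 : Φ 0 p.2 = p.2 := h1.1
    simp only [pow_zero, Module.End.one_apply, h1, smul_eq_mul, mul_assoc]
    rfl
  · filter_upwards [h.hasDerivAt_comp (g := ((lieOp v ^ k) g).1)
      (SmoothFun.differentiableAt _) x₀] with p hp
    rw [pow_succ', Module.End.mul_apply, lieOp_apply]
    exact hp
  · exact (((SmoothFun.contDiff ((lieOp v ^ (N + 1)) g)).continuous.tendsto x₀).comp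
      ht).isBigO_one ℝ

end Properties

end SplittingFlow

/-! ### The logarithm as an odd series of vector fields, and the local error. -/

namespace SplittingFlow

variable {D : ℕ}

section Logarithm

open PowerSeries

theorem coeff_oddLieSeries (d : ℕ → SmoothVectorField D) (n : ℕ) :
    coeff n (oddLieSeries d) = if Odd n then lieOp (d n) else 0 := coeff_mk _ _

theorem coeff_oddLieSeries_of_even (d : ℕ → SmoothVectorField D) {n : ℕ} (hn : Even n) :
    coeff n (oddLieSeries d) = 0 := by
  rw [coeff_oddLieSeries, if_neg (Nat.not_odd_iff_even.2 hn)]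

theorem coeff_oddLieSeries_congr {d d' : ℕ → SmoothVectorField D} {n : ℕ} (h : d n = d' n) :
    coeff n (oddLieSeries d) = coeff n (oddLieSeries d') := by
  rw [coeff_oddLieSeries, coeff_oddLieSeries, h]

theorem formalExp_oddLieSeries_smoothMul (d : ℕ → SmoothVectorField D) (n : ℕ)
    (f g : SmoothFun D) :
    coeff n (formalExp (oddLieSeries d)) (smoothMul D f g) =
      ∑ ij ∈ Finset.HasAntidiagonal.antidiagonal n,
        smoothMul D (coeff ij.1 (formalExp (oddLieSeries d)) f)
          (coeff ij.2 (formalExp (oddLieSeries d)) g) := by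
  refine formalExp_apply_bilinear _ (coeff_oddLieSeries_of_even d (by simp)) (fun n f g => ?_) n f g
  rw [coeff_oddLieSeries]
  split_ifs
  · exact lieOp_smoothMul _ f g
  · simp

variable {X : ℕ → Module.End ℝ (SmoothFun D)}

/-- The next term of the logarithm of a multiplicative, symmetric family of operators. -/
theorem exists_next_vectorField
    (hmul : ∀ n f g, X n (smoothMul D f g) = ∑ ij ∈ Finset.HasAntidiagonal.antidiagonal n,
      smoothMul D (X ij.1 f) (X ij.2 g))
    (hsymm : ∀ n, n ≠ 0 → ∑ ij ∈ Finset.HasAntidiagonal.antidiagonal n,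
      (-1 : ℝ) ^ ij.2 • (X ij.1 * X ij.2) = 0)
    {n : ℕ} (hn : n ≠ 0) (d : ℕ → SmoothVectorField D)
    (hd : ∀ k < n, X k = coeff k (formalExp (oddLieSeries d))) :
    ∃ d' : ℕ → SmoothVectorField D, (∀ k < n, d' k = d k) ∧
      ∀ k < n + 1, X k = coeff k (formalExp (oddLieSeries d')) := by
  set S := fun k => coeff k (formalExp (oddLieSeries d)) with hS
  have hd : ∀ k < n, X k = S k := hd
  have hS0 : S 0 = 1 := coeff_zero_formalExp _
  have hX0 : X 0 = 1 := (hd 0 (Nat.pos_of_ne_zero hn)).trans hS0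
  -- The mixed terms of `X` and `S` agree, and the end terms with `X 0 = S 0 = 1` leave the Leibniz
  -- rule for the defect.
  have hdmul : ∀ f g, (X n - S n) (smoothMul D f g) =
      smoothMul D ((X n - S n) f) g + smoothMul D f ((X n - S n) g) := by
    intro f g
    rw [LinearMap.sub_apply, hmul, formalExp_oddLieSeries_smoothMul, ← Finset.sum_sub_distrib,
      sum_antidiagonal_eq_add hn]
    · change smoothMul D (X n f) (X 0 g) - smoothMul D (S n f) (S 0 g) +
        (smoothMul D (X 0 f) (X n g) - smoothMul D (S 0 f) (S n g)) = _
      rw [hX0, hS0]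
      simp only [Module.End.one_apply, LinearMap.sub_apply, map_sub]
    · intro i j hij hi hj
      change smoothMul D (X i f) (X j g) - smoothMul D (S i f) (S j g) = 0
      rw [hd i (by omega), hd j (by omega), sub_self]
  rcases Nat.even_or_odd n with hev | hodd
  -- In even degree nothing can be adjusted, but symmetry already forces `X n = S n`.
  · refine ⟨d, fun _ _ => rfl, fun k hk => ?_⟩
    rcases Nat.lt_succ_iff_lt_or_eq.1 hk with h | rfl
    · exact hd k h
    exact eq_of_symmetric_of_even hn hev hX0 hd (hsymm k hn)
      (sum_antidiagonal_formalExp_odd (fun n hn => coeff_oddLieSeries_of_even d hn) hn)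
  -- The old `d n` already contributes `lieOp (d n)` to `S n`, so the new field is the old one plus
  -- the defect.
  · obtain ⟨v, hv⟩ : ∃ v, X n - S n + lieOp (d n) = lieOp v := by
      refine ⟨_, eq_lieOp_of_derivation _ fun f g => ?_⟩
      simp only [LinearMap.add_apply, hdmul, lieOp_smoothMul, map_add]
      abel
    obtain ⟨d', hlt, heq⟩ : ∃ d' : ℕ → SmoothVectorField D, (∀ k < n, d' k = d k) ∧ d' n = v :=
      ⟨Function.update d n v, fun k hk => Function.update_of_ne hk.ne _ _,
        Function.update_self _ _ _⟩
    have hlow : ∀ k < n, coeff k (oddLieSeries d') = coeff k (oddLieSeries d) := fun k hk =>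
      coeff_oddLieSeries_congr (hlt k hk)
    have hZ : coeff n (oddLieSeries d') =
        X n - coeff n (formalExp (oddLieSeries d)) + coeff n (oddLieSeries d) := by
      rw [coeff_oddLieSeries, coeff_oddLieSeries, if_pos hodd, if_pos hodd, heq]
      exact hv.symm
    refine ⟨d', hlt, fun k hk => ?_⟩
    rcases Nat.lt_succ_iff_lt_or_eq.1 hk with h | h
    · rw [coeff_formalExp_congr hlow h]
      exact hd k h
    · rw [h]
      have e1 := coeff_oddLieSeries_of_even d' (n := 0) (by simp)
      have e2 := coeff_oddLieSeries_of_even d (n := 0) (by simp)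
      have h3 := @coeff_formalExp_eq_of_coeff_eq (Module.End ℝ (SmoothFun D)) _ _
        (oddLieSeries d') (oddLieSeries d)
      have h4 := @h3 (by exact e1) (by exact e2) n
      have h5 := @h4 (by exact hn) (by exact hlow) (X n)
      exact (h5 (by exact hZ)).symm

/-- A multiplicative and symmetric family of operators is the exponential of an odd series of Lie
operators of vector fields. -/
theorem exists_eq_formalExp_oddLieSeries
    (hmul : ∀ n f g, X n (smoothMul D f g) = ∑ ij ∈ Finset.HasAntidiagonal.antidiagonal n,
      smoothMul D (X ij.1 f) (X ij.2 g))
    (hsymm : ∀ n, n ≠ 0 → ∑ ij ∈ Finset.HasAntidiagonal.antidiagonal n,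
      (-1 : ℝ) ^ ij.2 • (X ij.1 * X ij.2) = 0)
    (v : SmoothVectorField D) (h0 : X 0 = 1) (h1 : X 1 = lieOp v) :
    ∃ d : ℕ → SmoothVectorField D, d 1 = v ∧
      ∀ k, X k = coeff k (formalExp (oddLieSeries d)) := by
  choose next hnext₁ hnext₂ using
    fun (n : ℕ) => exists_next_vectorField hmul hsymm (n := n + 2) (by omega)
  have hbase : ∀ k < 2, X k = coeff k (formalExp (oddLieSeries fun _ => v)) := by
    intro k hk
    interval_cases k
    · exact h0.trans (coeff_zero_formalExp (R := Module.End ℝ (SmoothFun D)) _).symm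
    · refine Eq.trans ?_ (coeff_one_formalExp (R := Module.End ℝ (SmoothFun D))
        (coeff_oddLieSeries_of_even _ (by simp))).symm
      rw [coeff_oddLieSeries, if_pos odd_one, h1]
  -- Stage `n` is correct in degrees below `n + 2` and later stages leave those entries alone, so
  -- the diagonal is correct in every degree.
  let seq : (n : ℕ) → {d : ℕ → SmoothVectorField D //
      ∀ k < n + 2, X k = coeff k (formalExp (oddLieSeries d))} := fun n =>
    Nat.rec ⟨fun _ => v, hbase⟩ (fun n s => ⟨next n s.1 s.2, hnext₂ n s.1 s.2⟩) n
  have hstep : ∀ n, ∀ k < n + 2, (seq (n + 1)).1 k = (seq n).1 k := fun n =>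
    hnext₁ n (seq n).1 (seq n).2
  have hcoh : ∀ n m, n ≤ m → ∀ k < n + 2, (seq m).1 k = (seq n).1 k := by
    intro n m hnm
    induction m, hnm using Nat.le_induction with
    | base => exact fun _ _ => rfl
    | succ m hm ih => exact fun k hk => (hstep m k (by omega)).trans (ih k hk)
  refine ⟨fun k => (seq k).1 k, hcoh 0 1 (by omega) 1 (by omega), fun k => ?_⟩
  rw [(seq k).2 k (by omega)]
  refine coeff_formalExp_congr (n := k + 1) (fun j hj => ?_) (by omega)
  exact coeff_oddLieSeries_congr (hcoh j k (by omega) j (by omega))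

theorem coeff_three_formalExp_oddLieSeries (d : ℕ → SmoothVectorField D) :
    coeff 3 (formalExp (oddLieSeries d)) =
      (((3 : ℕ).factorial : ℝ)⁻¹) • lieOp (d 1) ^ 3 + lieOp (d 3) := by
  have h := coeff_three_formalExp (R := Module.End ℝ (SmoothFun D))
    (coeff_oddLieSeries_of_even d (n := 0) (by simp))
    (coeff_oddLieSeries_of_even d (n := 2) (by simp))
  rwa [coeff_oddLieSeries, coeff_oddLieSeries, if_pos (by decide), if_pos (by decide)] at h

end Logarithm

theorem isBigO_of_coords {α : Type*} {l : Filter α} {u : α → Phase D} {w : α → ℝ}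
    (h : ∀ i, (fun p => u p i) =O[l] w) : u =O[l] w := by
  have h1 : (fun p => ∑ i, u p i • EuclideanSpace.single i (1 : ℝ)) =O[l] w :=
    IsBigO.fun_sum fun i _ => IsBigO.trans (IsBigO.of_bound 1 (Eventually.of_forall fun p => by
      rw [norm_smul, PiLp.norm_single, norm_one, mul_one, one_mul])) (h i)
  refine h1.congr_left fun p => ?_
  simpa using (EuclideanSpace.basisFun (Fin D) ℝ).sum_repr (u p)

section Symmetric

variable {fb : SmoothVectorField D} {φb χ : ℝ → Phase D → Phase D}

theorem IsSymmetricSecondOrder.apply_zero (hχ : IsSymmetricSecondOrder φb χ)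
    (hφb : IsLocalFlow fb.1 φb) (x : Phase D) : χ 0 x = x := by
  obtain ⟨C, hC⟩ := (hχ.order_two x).bound
  have h1 := hC.self_of_nhds
  have h2 : φb 0 x = x := (hφb x).self_of_nhds.1
  simp only [h2, ne_eq, OfNat.ofNat_ne_zero, not_false_eq_true, zero_pow, norm_zero, mul_zero,
    norm_le_zero_iff] at h1
  exact sub_eq_zero.1 h1

theorem IsSymmetricSecondOrder.tendsto (hχ : IsSymmetricSecondOrder φb χ)
    (hφb : IsLocalFlow fb.1 φb) (x : Phase D) :
    Tendsto (fun p : ℝ × Phase D => χ p.1 p.2) (𝓝 (0, x)) (𝓝 x) := by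
  have := (hχ.smooth x).continuousAt.tendsto
  rwa [hχ.apply_zero hφb] at this

/-- The backward error expansion of a symmetric integrator of order two. -/
theorem IsSymmetricSecondOrder.exists_vectorFields (hχ : IsSymmetricSecondOrder φb χ)
    (hφb : IsLocalFlow fb.1 φb) :
    ∃ d : ℕ → SmoothVectorField D, d 1 = fb ∧
      HasUniformSeries χ fun k => PowerSeries.coeff k (formalExp (oddLieSeries d)) := by
  obtain ⟨X, hX⟩ := exists_hasUniformSeries hχ.smooth
  have ht := hχ.tendsto hφb
  have h1 : X 1 = lieOp fb := by
    have := hX.congr hφb.hasUniformSeries (n := 2) ht (fun x => hφb.tendsto fb.2.continuous x)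
      hχ.order_two (k := 1) (by norm_num)
    simpa using this
  obtain ⟨d, hd, hdX⟩ := exists_eq_formalExp_oddLieSeries hX.apply_smoothMul
    (fun n hn => hX.sum_antidiagonal_symm ht hχ.symm hn) fb
    (hX.zero_eq_one (hχ.apply_zero hφb)) h1
  refine ⟨d, hd, ?_⟩
  rwa [← funext hdX]

/-- The local error of a symmetric integrator of order two. -/
theorem IsSymmetricSecondOrder.exists_local_error (hχ : IsSymmetricSecondOrder φb χ)
    (hφb : IsLocalFlow fb.1 φb) {d : ℕ → SmoothVectorField D} (hd : d 1 = fb)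
    (hX : HasUniformSeries χ fun k => PowerSeries.coeff k (formalExp (oddLieSeries d))) :
    ∃ e : SmoothVectorField D, ∀ x₀, (fun p : ℝ × Phase D => χ p.1 p.2 - φb p.1 p.2 -
      p.1 ^ 3 • (d 3).1 p.2 - p.1 ^ 4 • e.1 p.2) =O[𝓝 (0, x₀)] fun p => p.1 ^ 5 := by
  set X := fun k => PowerSeries.coeff k (formalExp (oddLieSeries d)) with hXdef
  have hY := hφb.hasUniformSeries
  set Y := fun k : ℕ => ((k.factorial : ℝ)⁻¹) • lieOp fb ^ k with hYdef
  have hlow : ∀ k ≤ 2, X k = Y k := fun k hk => hX.congr hY (n := 2) (hχ.tendsto hφb)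
    (fun x => hφb.tendsto fb.2.continuous x) hχ.order_two hk
  have h3 : X 3 = Y 3 + lieOp (d 3) := by
    simp only [hXdef, hYdef, coeff_three_formalExp_oddLieSeries, hd]
  -- `X 4 - Y 4` need not be a derivation; `e` only records its values on the coordinate functions,
  -- which is all that an expansion of `χ - φb` requires.
  refine ⟨vectorFieldOfCoords fun i => (X 4 - Y 4) (coordFun i), fun x₀ => ?_⟩
  refine isBigO_of_coords fun i => ?_
  have hi : ∀ (v : SmoothVectorField D) (x : Phase D), v.1 x i = (lieOp v (coordFun i)).1 x := by
    intro v x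
    have : (coordFun i).1 = (EuclideanSpace.proj i : Phase D →L[ℝ] ℝ) := rfl
    rw [lieOp_apply, this, ContinuousLinearMap.fderiv]
    rfl
  refine ((hX (coordFun i) x₀ 4).sub (hY (coordFun i) x₀ 4)).congr_left fun p => ?_
  have e3 : (X 3 (coordFun i)).1 p.2 = (Y 3 (coordFun i)).1 p.2 + (d 3).1 p.2 i := by
    rw [h3, hi]
    rfl
  have e4 : (X 4 (coordFun i)).1 p.2 = (Y 4 (coordFun i)).1 p.2 +
      ((X 4 - Y 4) (coordFun i)).1 p.2 := by
    change _ = (Y 4 (coordFun i)).1 p.2 + ((X 4 (coordFun i)).1 p.2 - (Y 4 (coordFun i)).1 p.2)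
    ring
  simp only [Finset.sum_range_succ, Finset.sum_range_zero, hlow 0 (by norm_num),
    hlow 1 (by norm_num), hlow 2 le_rfl, e3]
  rw [e4]
  simp only [coordFun_apply, PiLp.sub_apply, PiLp.smul_apply, smul_eq_mul,
    vectorFieldOfCoords_apply]
  ring

end Symmetric

/-! ### Generalized order and the theorem. -/

theorem tendsto_prodMk_prodMk_const (x : Phase D) :
    Tendsto (fun p : ℝ × ℝ => (p.1, p.2, x)) (𝓝 (0, 0)) (𝓝 (0, 0, x)) :=
  (by fun_prop : Continuous fun p : ℝ × ℝ => (p.1, p.2, x)).tendsto (0, 0)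

/-- A perturbation of a method which is bounded by the error terms preserves generalized order. -/
theorem HasGeneralizedOrder.of_perturbation {φ ψ ψ' : ℝ → ℝ → Phase D → Phase D} {r r' : List ℕ}
    (h : HasGeneralizedOrder φ ψ r) (hr' : r'.Pairwise (· ≥ ·))
    (hle : ∀ p : ℝ × ℝ, ∑ j : Fin r.length, |p.1| ^ ((j : ℕ) + 1) * |p.2| ^ (r.get j + 1) ≤
      ∑ j : Fin r'.length, |p.1| ^ ((j : ℕ) + 1) * |p.2| ^ (r'.get j + 1))
    (hψ : ∀ x, (fun p : ℝ × ℝ => ψ' p.1 p.2 x - ψ p.1 p.2 x) =O[𝓝 (0, 0)]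
      fun p => ∑ j : Fin r'.length, |p.1| ^ ((j : ℕ) + 1) * |p.2| ^ (r'.get j + 1)) :
    HasGeneralizedOrder φ ψ' r' := by
  refine ⟨hr', fun x => ?_⟩
  have h1 := (h.2 x).trans (IsBigO.of_bound 1 (g := fun p : ℝ × ℝ =>
    ∑ j : Fin r'.length, |p.1| ^ ((j : ℕ) + 1) * |p.2| ^ (r'.get j + 1))
    (Eventually.of_forall fun p => by
      rw [one_mul, Real.norm_of_nonneg (Finset.sum_nonneg fun _ _ => by positivity),
        Real.norm_of_nonneg (Finset.sum_nonneg fun _ _ => by positivity)]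
      exact hle p))
  refine ((hψ x).add h1).congr_left fun p => ?_
  abel

end SplittingFlow

theorem mainTheorem2 {D : ℕ} (fa fb : SplittingFlow.SmoothVectorField D)
    (φa φb : ℝ → SplittingFlow.Phase D → SplittingFlow.Phase D)
    (hφa : SplittingFlow.IsLocalFlow fa.1 φa)
    (hφb : SplittingFlow.IsLocalFlow fb.1 φb)
    (φ : ℝ → ℝ → SplittingFlow.Phase D → SplittingFlow.Phase D)
    (hφ : SplittingFlow.IsPerturbedFlow fa.1 fb.1 φ)
    (χ : ℝ → SplittingFlow.Phase D → SplittingFlow.Phase D)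
    (hχ : SplittingFlow.IsSymmetricSecondOrder φb χ) :
    ∃ d : ℕ → SplittingFlow.SmoothVectorField D,
      d 1 = fb ∧
      SplittingFlow.HasOperatorSeries χ
        (SplittingFlow.formalExp (SplittingFlow.oddLieSeries d)) ∧
      ∀ (s : ℕ) (a : Fin (s + 1) → ℝ) (b : Fin s → ℝ),
        (∀ (g : SplittingFlow.SmoothFun D) (x : SplittingFlow.Phase D),
          (fun p : ℝ × ℝ =>
            g.1 (SplittingFlow.splitting φa χ s a b p.1 p.2 x) -
              g.1 (SplittingFlow.splitting φa φb s a b p.1 p.2 x) -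
              (∑ j, b j ^ 3) * p.1 ^ 3 * p.2 ^ 3 * (SplittingFlow.lieOp (d 3) g).1 x)
            =O[𝓝 (0, 0)] fun p : ℝ × ℝ => p.1 ^ 3 * p.2 ^ 4) ∧
        (SplittingFlow.IsPalindromic a b → ∀ r : ℕ,
          SplittingFlow.HasGeneralizedOrder φ (SplittingFlow.splitting φa φb s a b) [r, 4] →
            SplittingFlow.HasGeneralizedOrder φ (SplittingFlow.splitting φa χ s a b) [r, 4, 2] ∧
            (∑ j, b j ^ 3 = 0 →
              SplittingFlow.HasGeneralizedOrder φ (SplittingFlow.splitting φa χ s a b)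
                [r, 4])) := by
  obtain ⟨d, hd, hX⟩ := hχ.exists_vectorFields hφb
  obtain ⟨e, he⟩ := hχ.exists_local_error hφb hd hX
  refine ⟨d, hd, hX.at_point, fun s a b => ?_⟩
  -- A general codomain serves both the real observables and `g = id`.
  have hdiff : ∀ {F : Type} [NormedAddCommGroup F] [NormedSpace ℝ F]
      {g : SplittingFlow.Phase D → F} (_ : ContDiff ℝ ∞ g) (x : SplittingFlow.Phase D),
      (fun p : ℝ × ℝ => g (SplittingFlow.splitting φa χ s a b p.1 p.2 x) -
        g (SplittingFlow.splitting φa φb s a b p.1 p.2 x) -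
        ((∑ j, b j ^ 3) * p.1 ^ 3 * p.2 ^ 3) • fderiv ℝ g x ((d 3).1 x))
        =O[𝓝 (0, 0)] fun p : ℝ × ℝ => p.1 ^ 3 * p.2 ^ 4 := fun hg x =>
    (SplittingFlow.splitting_observable_difference fa.2 fb.2 (d 3).2 e.2 hφa hφb he s a b hg
      x).comp_tendsto (SplittingFlow.tendsto_prodMk_prodMk_const x)
  refine ⟨fun g x => hdiff (SplittingFlow.SmoothFun.contDiff g) x, fun hab r hr => ⟨?_, ?_⟩⟩
  · have hr4 : 4 ≤ r := by simpa using hr.1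
    refine hr.of_perturbation (by simp; omega) (fun p => ?_) fun x => ?_
    · simp only [List.length_cons, List.length_nil, zero_add, Nat.reduceAdd,
        Fin.sum_univ_succ, Finset.univ_eq_empty, Finset.sum_empty, List.get_eq_getElem,
        Fin.val_zero, Fin.val_succ, List.getElem_cons_zero, List.getElem_cons_succ, add_zero]
      gcongr
      exact le_add_of_nonneg_right (by positivity)
    -- `g = id` recovers the difference of the schemes, which is `O(ε³τ³)`: the third term of the
    -- order `(r, 4, 2)`.
    · have h1 := hdiff (g := id) contDiff_id x
      have h2 : (fun p : ℝ × ℝ => p.1 ^ 3 * p.2 ^ 4) =O[𝓝 (0, 0)]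
          fun p : ℝ × ℝ => p.1 ^ 3 * p.2 ^ 3 :=
        (SplittingFlow.monomial_isBigO (x₀ := x) (le_refl 3) (by norm_num : 3 ≤ 4)).comp_tendsto
          (SplittingFlow.tendsto_prodMk_prodMk_const x)
      have h3 : (fun p : ℝ × ℝ => ((∑ j, b j ^ 3) * p.1 ^ 3 * p.2 ^ 3) •
          fderiv ℝ id x ((d 3).1 x)) =O[𝓝 (0, 0)] fun p : ℝ × ℝ => p.1 ^ 3 * p.2 ^ 3 := by
        refine IsBigO.of_bound (|∑ j, b j ^ 3| * ‖fderiv ℝ id x ((d 3).1 x)‖)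
          (Eventually.of_forall fun p => le_of_eq ?_)
        simp only [norm_smul, norm_mul, Real.norm_eq_abs]
        ring
      have h4 : (fun p : ℝ × ℝ => SplittingFlow.splitting φa χ s a b p.1 p.2 x -
          SplittingFlow.splitting φa φb s a b p.1 p.2 x) =O[𝓝 (0, 0)]
          fun p : ℝ × ℝ => p.1 ^ 3 * p.2 ^ 3 :=
        ((h1.trans h2).add h3).congr_left fun p => by simp only [id_eq]; abel
      refine h4.trans (IsBigO.of_bound 1 (Eventually.of_forall fun p => ?_))
      simp only [List.length_cons, List.length_nil, zero_add, Nat.reduceAdd,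
        Fin.sum_univ_succ, Finset.univ_eq_empty, Finset.sum_empty, List.get_eq_getElem,
        Fin.val_zero, Fin.val_succ, List.getElem_cons_zero, List.getElem_cons_succ, add_zero,
        norm_mul, norm_pow, Real.norm_eq_abs, one_mul]
      refine le_trans ?_ (le_abs_self _)
      have h5 : 0 ≤ |p.1| ^ 1 * |p.2| ^ (r + 1) := by positivity
      have h6 : 0 ≤ |p.1| ^ 2 * |p.2| ^ 5 := by positivity
      linarith
  · intro hb
    refine hr.of_perturbation hr.1 (fun p => le_rfl) fun x => ?_
    -- `ε³τ⁵` is weakened to `ε²τ⁵`, the second term of the order `(r, 4)`.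
    have h1 := (SplittingFlow.splitting_sub_splitting_isBigO_of_palindromic fa.2 fb.2 (d 3).2 e.2
      hφa hφb he (hχ.tendsto hφb) hχ.symm hab hb x).weaken (by norm_num : 2 ≤ 3) le_rfl
    have h2 := h1.comp_tendsto (SplittingFlow.tendsto_prodMk_prodMk_const x)
    refine h2.trans (IsBigO.of_bound 1 (Eventually.of_forall fun p => ?_))
    simp only [SplittingFlow.monomial, Function.comp_apply, List.length_cons, List.length_nil,
      zero_add, Nat.reduceAdd, Fin.sum_univ_succ, Finset.univ_eq_empty, Finset.sum_empty,
      List.get_eq_getElem, Fin.val_zero, Fin.val_succ, List.getElem_cons_zero,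
      List.getElem_cons_succ, add_zero, norm_mul, norm_pow, Real.norm_eq_abs, one_mul]
    refine le_trans ?_ (le_abs_self _)
    have h5 : 0 ≤ |p.1| ^ 1 * |p.2| ^ (r + 1) := by positivity
    linarith
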